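/- Conventions. Fix $n\in\mathbb N_0$. The Fourier transform is $\mathcal F f(\xi)=(2\pi)^{-n/2}\int_{\mathbb R^n} f(x)e^{-ix\cdot\xi}\,dx$, extended to tempered distributions. Let $\rho:\mathbb R^n\to[0,1]$ be a fixed smooth window with $\operatorname{supp}\rho\subset\{\xi:\max_i|\xi_i|\le1\}$ and $\rho(\xi)=1$ if $\max_i|\xi_i|\le\frac12$. Put $\sigma_k(\xi)=\rho(\xi-k)\big(\sum_{m\in\mathbb Z^n}\rho(\xi-m)\big)^{-1}$ and $\Box_k f=\mathcal F^{-1}(\sigma_k\mathcal F f)$ for $k\in\mathbb Z^n$. For $1\le p,q\le\infty$ and a weight $w_*:[0,\infty)\to\mathbb R$, the space $\mathcal M^{w_*}_{p,q}(\mathbb R^n)$ consists of all complex-valued $f\in L^p(\mathbb R^n)$ with \[ \|f\|_{\mathcal M^{w_*}_{p,q}}:=\Big(\sum_{k\in\mathbb Z^n}e^{q\,w_*(|k|)}\|\Box_k f\|_{L^p}^q\Big)^{1/q}<\infty \] (supremum over $k$ if $q=\infty$), where $|k|$ is the Euclidean norm. A measurable $f:(0,\infty)\to(0,\infty)$ is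 regularly varying of index $\alpha$ if $\lim_{t\to\infty}f(tx)/f(t)=x^\alpha$ for all $x>0$, and slowly varying if this holds with $\alpha=0$. Let $\mathcal W_0(\mathbb R)$ be the set of all functions $w_*:[0,\infty)\to\mathbb R$ that are $C^\infty$ and slowly varying on $(0,\infty)$, satisfy $w_*\ge1$, are strictly increasing, satisfy $\lim_{t\to\infty}(w_*(t)-M\log t)=\infty$ for every $M\in\mathbb R$, satisfy $w_*'(0)=0$ (one-sided derivative), and for which there is $\tau\ge0$ with $w_*''(x)<0$ for all $x>\tau$. For $R>0$ and $\epsilon\in\{0,1\}^n$ let \[ P_R(\epsilon):=\{\xi\in\mathbb R^n:\operatorname{sgn}(\xi_j)=(-1)^{\epsilon_j},\ j=1,\dots,n\}\setminus\{\xi\in\mathbb R^n:|\xi_j|\le R,\ j=1,\dots,n\}, \] \[ \mathcal M^{w_*}_{p,q}(\epsilon,R):=\{f\in\mathcal M^{w_*}_{p,q}(\mathbb R^n):\operatorname{supp}\mathcal F f\subset P_R(\epsilon)\}. \] Proposition. Let $1\le p,q\le\infty$ and let $w_*\in\mathcal W_0(\mathbb R)$ be fixed. For every $\epsilon\in\{0,1\}^n$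 and every $R\ge2$, the space $\mathcal M^{w_*}_{p,q}(\epsilon,R)$ is a subalgebra of the algebra (under pointwise multiplication) $\mathcal M^{w_*}_{p,q}(\mathbb R^n)$. Furthermore, for every $N\in\mathbb N$ there is a constant $C_N>0$, depending only on $n,p,q,N$, the fixed weight $w_*$ and the fixed window $\rho$, but not on $f,g,R,\epsilon$, such that \[ \|f\,g\|_{\mathcal M^{w_*}_{p,q}}\le C_N R^{-N}\,\|f\|_{\mathcal M^{w_*}_{p,q}}\,\|g\|_{\mathcal M^{w_*}_{p,q}} \] for all $R\ge2$, all $\epsilon\in\{0,1\}^n$ and all $f,g\in\mathcal M^{w_*}_{p,q}(\epsilon,R)$. -/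

import Mathlib

open scoped ENNReal ContDiff SchwartzMap FourierTransform
open MeasureTheory Filter Topology

noncomputable section

namespace UltraMod

/-- Euclidean space `ℝⁿ`. -/
abbrev E (n : ℕ) : Type := EuclideanSpace ℝ (Fin n)

/-- The lattice point `k ∈ ℤⁿ` regarded as a vector of `ℝⁿ`. -/
def lat {n : ℕ} (k : Fin n → ℤ) : E n := WithLp.toLp 2 fun i => (k i : ℝ)

/-! ### The Fourier transform with unitary angular-frequency normalization -/

/-- Dilation of Schwartz functions, `φ ↦ (ξ ↦ φ ((2π)⁻¹ ξ))`. -/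
def dilate (n : ℕ) : 𝓢(E n, ℂ) →L[ℂ] 𝓢(E n, ℂ) :=
  SchwartzMap.compCLMOfContinuousLinearEquiv ℂ
    (ContinuousLinearEquiv.smulLeft
      (Units.mk0 ((2 * Real.pi)⁻¹ : ℝ) (inv_ne_zero Real.two_pi_pos.ne')) : E n ≃L[ℝ] E n)

/-- `𝓕 φ (ξ) = (2π)^(-n/2) ∫ φ(x) e^{-i x·ξ} dx` on Schwartz functions, obtained from Mathlib's
Fourier transform by rescaling; see `schwartzFourier_apply`. -/
def schwartzFourier (n : ℕ) : 𝓢(E n, ℂ) →L[ℂ] 𝓢(E n, ℂ) :=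
  (((2 * Real.pi) ^ (-(n : ℝ) / 2) : ℝ) : ℂ) •
    (dilate n ∘L FourierTransform.fourierCLM ℂ 𝓢(E n, ℂ))

/-- `𝓕⁻¹ φ (x) = (2π)^(-n/2) ∫ φ(ξ) e^{i x·ξ} dξ` on Schwartz functions;
see `schwartzFourierInv_apply`. -/
def schwartzFourierInv (n : ℕ) : 𝓢(E n, ℂ) →L[ℂ] 𝓢(E n, ℂ) :=
  (((2 * Real.pi) ^ (-(n : ℝ) / 2) : ℝ) : ℂ) •
    (dilate n ∘L FourierTransform.fourierInvCLM ℂ 𝓢(E n, ℂ))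

theorem schwartzFourier_apply {n : ℕ} (φ : 𝓢(E n, ℂ)) (ξ : E n) :
    schwartzFourier n φ ξ = (((2 * Real.pi) ^ (-(n : ℝ) / 2) : ℝ) : ℂ) *
      ∫ x, Complex.exp (-Complex.I * (inner ℝ x ξ : ℝ)) * φ x := by
  have hpi : (Real.pi : ℂ) ≠ 0 := by exact_mod_cast Real.pi_ne_zero
  change _ * (𝓕 φ) ((2 * Real.pi)⁻¹ • ξ) = _
  rw [SchwartzMap.fourier_coe, Real.fourier_eq']
  congr 2
  funext x
  rw [smul_eq_mul, inner_smul_right]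
  congr 2
  push_cast
  field_simp

theorem schwartzFourierInv_apply {n : ℕ} (φ : 𝓢(E n, ℂ)) (x : E n) :
    schwartzFourierInv n φ x = (((2 * Real.pi) ^ (-(n : ℝ) / 2) : ℝ) : ℂ) *
      ∫ ξ, Complex.exp (Complex.I * (inner ℝ ξ x : ℝ)) * φ ξ := by
  have hpi : (Real.pi : ℂ) ≠ 0 := by exact_mod_cast Real.pi_ne_zero
  change _ * (𝓕⁻ φ) ((2 * Real.pi)⁻¹ • x) = _
  rw [SchwartzMap.fourierInv_coe, Real.fourierInv_eq']
  congr 2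
  funext ξ
  rw [smul_eq_mul, inner_smul_right]
  congr 2
  push_cast
  field_simp

/-- The Fourier transform of tempered distributions, `(𝓕 T)(φ) = T(𝓕 φ)`. -/
def distFourier (n : ℕ) : 𝓢'(E n, ℂ) →L[ℂ] 𝓢'(E n, ℂ) :=
  PointwiseConvergenceCLM.precomp ℂ (schwartzFourier n)

/-- The inverse Fourier transform of tempered distributions, `(𝓕⁻¹ T)(φ) = T(𝓕⁻¹ φ)`. -/
def distFourierInv (n : ℕ) : 𝓢'(E n, ℂ) →L[ℂ] 𝓢'(E n, ℂ) :=
  PointwiseConvergenceCLM.precomp ℂ (schwartzFourierInv n)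

/-! ### Frequency-uniform decomposition -/

/-- Admissible windows: smooth `ρ : ℝⁿ → [0,1]` supported in the cube `max |ξᵢ| ≤ 1` and equal to
`1` on the cube `max |ξᵢ| ≤ 1/2`. -/
structure IsWindow {n : ℕ} (ρ : E n → ℝ) : Prop where
  smooth : ContDiff ℝ ∞ ρ
  nonneg : ∀ ξ, 0 ≤ ρ ξ
  le_one : ∀ ξ, ρ ξ ≤ 1
  supp : tsupport ρ ⊆ {ξ | ∀ i, |ξ i| ≤ 1}
  eq_one : ∀ ξ : E n, (∀ i, |ξ i| ≤ 1 / 2) → ρ ξ = 1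

/-- `σ_k(ξ) = ρ(ξ - k) / ∑_m ρ(ξ - m)`; the sum is locally finite. -/
def sigma {n : ℕ} (ρ : E n → ℝ) (k : Fin n → ℤ) (ξ : E n) : ℝ :=
  ρ (ξ - lat k) / ∑' m : Fin n → ℤ, ρ (ξ - lat m)

/-- The uniform decomposition operator `□_k T = 𝓕⁻¹ (σ_k 𝓕 T)`. -/
def box {n : ℕ} (ρ : E n → ℝ) (k : Fin n → ℤ) (T : 𝓢'(E n, ℂ)) : 𝓢'(E n, ℂ) :=
  distFourierInv n
    (TemperedDistribution.smulLeftCLM ℂ (fun ξ => (sigma ρ k ξ : ℂ)) (distFourier n T))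

/-- The `Lᵖ` norm of a tempered distribution: the norm of the (unique) `Lᵖ` function representing
it, and `∞` if there is none. -/
def distLpNorm {n : ℕ} (p : ℝ≥0∞) [Fact (1 ≤ p)] (T : 𝓢'(E n, ℂ)) : ℝ≥0∞ :=
  ⨅ (h : Lp ℂ p (volume : Measure (E n))) (_ : Lp.toTemperedDistribution h = T), ‖h‖ₑ

open scoped Classical in
/-- The tempered distribution `φ ↦ ∫ φ f` defined by a function `f ∈ Lᵖ`
(and `0` if `f ∉ Lᵖ`; this case is never used). -/
def toDist {n : ℕ} (p : ℝ≥0∞) [Fact (1 ≤ p)] (f : E n → ℂ) : 𝓢'(E n, ℂ) :=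
  if hf : MemLp f p volume then Lp.toTemperedDistribution (hf.toLp f) else 0

/-! ### Modulation spaces -/

/-- The `ℓ^q(ℤⁿ)` norm of a family of extended nonnegative numbers. -/
def ellNorm {n : ℕ} (q : ℝ≥0∞) (a : (Fin n → ℤ) → ℝ≥0∞) : ℝ≥0∞ :=
  if q = ⊤ then ⨆ k, a k else (∑' k, a k ^ q.toReal) ^ (1 / q.toReal)

open scoped Classical in
/-- `‖f‖ = (∑_k e^{q w(|k|)} ‖□_k f‖_{Lᵖ}^q)^{1/q}`, for `f ∈ Lᵖ`; it is `∞` for `f ∉ Lᵖ`. -/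
def modNorm {n : ℕ} (ρ : E n → ℝ) (w : ℝ → ℝ) (p q : ℝ≥0∞) [Fact (1 ≤ p)] (f : E n → ℂ) : ℝ≥0∞ :=
  if MemLp f p volume then
    ellNorm q fun k => ENNReal.ofReal (Real.exp (w ‖lat k‖)) * distLpNorm p (box ρ k (toDist p f))
  else ⊤

/-- The weighted modulation space, as a set of functions (closed under a.e. modification). -/
def modSpace {n : ℕ} (ρ : E n → ℝ) (w : ℝ → ℝ) (p q : ℝ≥0∞) [Fact (1 ≤ p)] : Set (E n → ℂ) :=
  {f | MemLp f p volume ∧ modNorm ρ w p q f < ⊤}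

/-- The cube `P_R`. -/
def cube (n : ℕ) (R : ℝ) : Set (E n) := {ξ | ∀ j, |ξ j| ≤ R}

/-- `P_R(ε) = {ξ : sgn ξ_j = (-1)^{ε_j} for all j} \ P_R`. -/
def orthant {n : ℕ} (ε : Fin n → Fin 2) (R : ℝ) : Set (E n) :=
  {ξ | ∀ j, Real.sign (ξ j) = (-1) ^ (ε j : ℕ)} \ cube n R

/-- The functions of the modulation space whose Fourier transform is supported in `P_R(ε)`. -/
def modSpaceSupp {n : ℕ} (ρ : E n → ℝ) (w : ℝ → ℝ) (p q : ℝ≥0∞) [Fact (1 ≤ p)]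
    (ε : Fin n → Fin 2) (R : ℝ) : Set (E n → ℂ) :=
  {f | f ∈ modSpace ρ w p q ∧ Distribution.dsupport (distFourier n (toDist p f)) ⊆ orthant ε R}

/-! ### Weight functions -/

/-- `f : (0,∞) → (0,∞)` is measurable and regularly varying of index `α`. -/
def RegularlyVarying (f : ℝ → ℝ) (α : ℝ) : Prop :=
  Measurable (fun x : Set.Ioi (0 : ℝ) => f x) ∧ (∀ x > 0, 0 < f x) ∧
    ∀ x > 0, Tendsto (fun t => f (t * x) / f t) atTop (𝓝 (x ^ α))

/-- `f : (0,∞) → (0,∞)` is measurable and slowly varying. -/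
def SlowlyVarying (f : ℝ → ℝ) : Prop :=
  Measurable (fun x : Set.Ioi (0 : ℝ) => f x) ∧ (∀ x > 0, 0 < f x) ∧
    ∀ x > 0, Tendsto (fun t => f (t * x) / f t) atTop (𝓝 1)

/-- The class `𝒲(ℝ)`. A weight is a function on `[0,∞)`; it is represented by a function on `ℝ`
of which only the values on `[0,∞)` matter. -/
structure IsWeight (w : ℝ → ℝ) : Prop where
  smooth : ContDiffOn ℝ ∞ w (Set.Ioi 0)
  regular : ∃ α : ℝ, 0 ≤ α ∧ α < 1 ∧ RegularlyVarying w α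
  one_le : ∀ t, 0 ≤ t → 1 ≤ w t
  strictMono : StrictMonoOn w (Set.Ici 0)
  growth : ∀ M : ℝ, Tendsto (fun t => w t - M * Real.log t) atTop atTop
  deriv_zero : HasDerivWithinAt w 0 (Set.Ici 0) 0
  concave : ∃ τ : ℝ, 0 ≤ τ ∧ ∀ x > τ, iteratedDeriv 2 w x < 0

/-- The class `𝒲₀(ℝ)` of slowly varying weights. -/
def weightsZero : Set (ℝ → ℝ) := {w | IsWeight w ∧ SlowlyVarying w}

end UltraMod

end

noncomputable section

namespace UltraMod

/-! ### Young's inequality -/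

/-! The estimate reduces to one about sequences. A piece `□_k (□_l f · □_m g)` vanishes unless `k`
is within 3 of `l + m` in every coordinate, since spectra add under multiplication and each piece
lives on a cube of half-width 1. By Bernstein's inequality `□_m g` is bounded in `L^∞` by its `L^p`
norm, with a constant independent of `m` because the symbols are translates of one another. So `‖□_k
(f g)‖_p` is dominated by an almost-convolution of the sequences `‖□_l f‖_p` and `‖□_m g‖_p`
(`eLpNorm_op_mul_le`).

The weight enters through `exp_weight_le`. For `a ≤ b` and `s ≤ a + b + c`, concavity and slow
variation give `w s ≤ w b + w a / 2 + C`; the unused half of `w a` beats any power of `1 + a`. Of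
this polynomial gain, `2n` powers make one factor summable, so that Young's inequality `ℓ¹ * ℓ^q ⊆
ℓ^q` applies, and the other `N` powers become `R^(-N)`, because a function with spectrum in `P_R(ε)`
has only pieces with `R ≤ 1 + |l|`.

Two points of rigour remain. The pieces are absolutely summable in `L^p` and in `L^∞`, so `f g` is
the `L^p` limit of products of partial sums (`memLp_of_decomposition`). For the spectrum of `f g`,
sums of points of an orthant cannot cancel: the sum of the two closed spectra is closed, lies in
`P_R(ε)`, and contains the spectrum of the product (`Decomposable.spec_mul_subset`). -/

theorem lintegral_young {G : Type*} [AddCommGroup G] [MeasurableSpace G] [MeasurableAdd₂ G]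
    [MeasurableNeg G] (μ : Measure G) [SFinite μ] [μ.IsAddLeftInvariant] [μ.IsNegInvariant]
    {p : ℝ} (hp : 1 ≤ p) {f k : G → ℝ≥0∞} (hf : AEMeasurable f μ) (hk : Measurable k) :
    ∫⁻ y, (∫⁻ x, f x * k (x - y) ∂μ) ^ p ∂μ ≤ (∫⁻ x, k x ∂μ) ^ p * ∫⁻ x, f x ^ p ∂μ := by
  have hp0 : 0 < p := by linarith
  have hright : ∀ y, ∫⁻ x, k (x - y) ∂μ = ∫⁻ x, k x ∂μ := fun y =>
    lintegral_sub_right_eq_self k y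
  have hleft : ∀ x, ∫⁻ y, k (x - y) ∂μ = ∫⁻ x, k x ∂μ := fun x =>
    lintegral_sub_left_eq_self k x
  have hk2 : Measurable fun z : G × G => k (z.2 - z.1) := by fun_prop
  have hpw : ∀ y, (∫⁻ x, f x * k (x - y) ∂μ) ^ p
      ≤ (∫⁻ x, f x ^ p * k (x - y) ∂μ) * (∫⁻ x, k x ∂μ) ^ (p - 1) := by
    intro y
    have hky : Measurable fun x => k (x - y) := by fun_prop
    -- Hölder for the splitting `f k = (f ^ p k) ^ (1/p) · k ^ (1 - 1/p)`; Tonelli and translation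
    -- invariance then finish.
    have key := ENNReal.lintegral_mul_norm_pow_le (μ := μ) (f := fun x => f x ^ p * k (x - y))
      (g := fun x => k (x - y)) ((hf.pow_const p).mul hky.aemeasurable) hky.aemeasurable
      (p := 1 / p) (q := 1 - 1 / p) (by positivity)
      (by rw [sub_nonneg, div_le_one hp0]; exact hp) (by ring)
    have heq : ∀ x, (f x ^ p * k (x - y)) ^ (1 / p) * k (x - y) ^ (1 - 1 / p)
        = f x * k (x - y) := by
      intro x
      rw [ENNReal.mul_rpow_of_nonneg _ _ (by positivity), ← ENNReal.rpow_mul,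
        mul_one_div_cancel hp0.ne', ENNReal.rpow_one, mul_assoc,
        ← ENNReal.rpow_add_of_nonneg _ _ (by positivity)
          (by rw [sub_nonneg, div_le_one hp0]; exact hp)]
      simp
    simp only [heq, hright] at key
    calc _ ≤ ((∫⁻ x, f x ^ p * k (x - y) ∂μ) ^ (1 / p) * (∫⁻ x, k x ∂μ) ^ (1 - 1 / p)) ^ p :=
          ENNReal.rpow_le_rpow key hp0.le
      _ = _ := by
        rw [ENNReal.mul_rpow_of_nonneg _ _ hp0.le, ← ENNReal.rpow_mul, ← ENNReal.rpow_mul,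
          one_div_mul_cancel hp0.ne', ENNReal.rpow_one]
        congr 2
        field_simp
  calc _ ≤ ∫⁻ y, (∫⁻ x, f x ^ p * k (x - y) ∂μ) * (∫⁻ x, k x ∂μ) ^ (p - 1) ∂μ :=
        lintegral_mono hpw
    _ = (∫⁻ x, ∫⁻ y, f x ^ p * k (x - y) ∂μ ∂μ) * (∫⁻ x, k x ∂μ) ^ (p - 1) := by
        have hm : AEMeasurable (Function.uncurry fun y x => f x ^ p * k (x - y)) (μ.prod μ) :=
          ((hf.comp_snd (f := f)).pow_const p).mul hk2.aemeasurable
        rw [lintegral_lintegral_swap (f := fun x y => f x ^ p * k (x - y)) hm.prod_swap]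
        exact lintegral_mul_const'' _ hm.lintegral_prod_right'
    _ = (∫⁻ x, f x ^ p ∂μ) * (∫⁻ x, k x ∂μ) * (∫⁻ x, k x ∂μ) ^ (p - 1) := by
        rw [← lintegral_mul_const'' _ (hf.pow_const p)]
        congr 2
        ext x
        rw [lintegral_const_mul _ (by fun_prop), hleft]
    _ = _ := by
        have : (∫⁻ x, k x ∂μ) * (∫⁻ x, k x ∂μ) ^ (p - 1) = (∫⁻ x, k x ∂μ) ^ p := by
          nth_rw 1 [← ENNReal.rpow_one (∫⁻ x, k x ∂μ)]
          rw [← ENNReal.rpow_add_of_nonneg _ _ zero_le_one (by linarith)]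
          simp
        rw [mul_assoc, this, mul_comm]

/-! ### The `ℓ^q` norm -/

section ellNorm

variable {n : ℕ} {q : ℝ≥0∞}

theorem toReal_pos_of_one_le (hq : 1 ≤ q) (h : q ≠ ⊤) : 0 < q.toReal :=
  ENNReal.toReal_pos (zero_lt_one.trans_le hq).ne' h

theorem one_le_toReal (hq : 1 ≤ q) (h : q ≠ ⊤) : 1 ≤ q.toReal := by
  simpa using ENNReal.toReal_mono h hq

theorem ellNorm_mono {a b : (Fin n → ℤ) → ℝ≥0∞} (h : ∀ k, a k ≤ b k) :
    ellNorm q a ≤ ellNorm q b := by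
  unfold ellNorm
  split_ifs with hqt
  · exact iSup_mono h
  · gcongr with k
    exact h k

theorem ellNorm_const_mul (hq : 1 ≤ q) (c : ℝ≥0∞) (a : (Fin n → ℤ) → ℝ≥0∞) :
    ellNorm q (fun k => c * a k) = c * ellNorm q a := by
  unfold ellNorm
  split_ifs with hqt
  · rw [ENNReal.mul_iSup]
  · have := toReal_pos_of_one_le hq hqt
    simp_rw [ENNReal.mul_rpow_of_nonneg _ _ this.le]
    rw [ENNReal.tsum_mul_left, ENNReal.mul_rpow_of_nonneg _ _ (by positivity),
      ← ENNReal.rpow_mul, mul_one_div_cancel this.ne', ENNReal.rpow_one]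

theorem ellNorm_add_le (hq : 1 ≤ q) (a b : (Fin n → ℤ) → ℝ≥0∞) :
    ellNorm q (fun k => a k + b k) ≤ ellNorm q a + ellNorm q b := by
  unfold ellNorm
  split_ifs with hqt
  · exact iSup_le fun k => add_le_add (le_iSup a k) (le_iSup b k)
  · have h0 := toReal_pos_of_one_le hq hqt
    rw [one_div, ENNReal.rpow_inv_le_iff h0, ENNReal.tsum_eq_iSup_sum]
    refine iSup_le fun s => ?_
    have key := ENNReal.Lp_add_le s a b (one_le_toReal hq hqt)
    rw [one_div, ENNReal.rpow_inv_le_iff h0] at key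
    refine key.trans ?_
    gcongr
    · exact ENNReal.sum_le_tsum s
    · exact ENNReal.sum_le_tsum s

theorem le_ellNorm (hq : 1 ≤ q) (a : (Fin n → ℤ) → ℝ≥0∞) (k : Fin n → ℤ) :
    a k ≤ ellNorm q a := by
  unfold ellNorm
  split_ifs with hqt
  · exact le_iSup a k
  · have := toReal_pos_of_one_le hq hqt
    calc a k = (a k ^ q.toReal) ^ (1 / q.toReal) := by
          rw [← ENNReal.rpow_mul, mul_one_div_cancel this.ne', ENNReal.rpow_one]
      _ ≤ _ := by
          gcongr
          exact ENNReal.le_tsum k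

/-- Young's inequality `ℓ¹ * ℓ^q ⊆ ℓ^q`. -/
theorem ellNorm_conv_le (hq : 1 ≤ q) (κ a : (Fin n → ℤ) → ℝ≥0∞) :
    ellNorm q (fun k => ∑' m, a m * κ (k - m)) ≤ (∑' i, κ i) * ellNorm q a := by
  have hneg : ∑' i, κ (-i) = ∑' i, κ i := (Equiv.neg (Fin n → ℤ)).tsum_eq κ
  unfold ellNorm
  split_ifs with hqt
  · refine iSup_le fun k => ?_
    calc ∑' m, a m * κ (k - m) ≤ ∑' m, (⨆ j, a j) * κ (k - m) := by
          gcongr with m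
          exact le_iSup a m
      _ = _ := by
          rw [ENNReal.tsum_mul_left, mul_comm]
          congr 1
          exact (Equiv.subLeft k).tsum_eq κ
  · have h0 := toReal_pos_of_one_le hq hqt
    -- The kernel is reflected because `lintegral_young` evaluates it at `x - y`, summing over `x`.
    have key := lintegral_young (Measure.count : Measure (Fin n → ℤ)) (one_le_toReal hq hqt)
      (f := a) (k := fun i => κ (-i)) (measurable_of_countable _).aemeasurable
      (measurable_of_countable _)
    simp only [lintegral_count, neg_sub, hneg] at key
    calc _ ≤ ((∑' i, κ i) ^ q.toReal * ∑' i, a i ^ q.toReal) ^ (1 / q.toReal) := by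
          gcongr
      _ = _ := by
          rw [ENNReal.mul_rpow_of_nonneg _ _ (by positivity), ← ENNReal.rpow_mul,
            mul_one_div_cancel h0.ne', ENNReal.rpow_one]

end ellNorm

/-! ### A summable weight on the lattice -/

theorem tsum_pi_prod (g : ℤ → ℝ≥0∞) (n : ℕ) :
    ∑' k : Fin n → ℤ, ∏ i, g (k i) = (∑' j, g j) ^ n := by
  induction n with
  | zero => simp
  | succ n ih =>
    rw [← (Fin.consEquiv fun _ : Fin (n + 1) => ℤ).tsum_eq,
      ENNReal.tsum_prod (f := fun a (b : Fin n → ℤ) => ∏ i, g (Fin.consEquiv (fun _ => ℤ) (a, b) i))]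
    simp only [Fin.consEquiv_apply, Fin.prod_univ_succ, Fin.cons_zero, Fin.cons_succ]
    simp_rw [ENNReal.tsum_mul_left, ih, ENNReal.tsum_mul_right]
    rw [pow_succ']

theorem summable_one_add_abs_int : Summable fun j : ℤ => ((1 + |(j : ℝ)|) ^ 2)⁻¹ := by
  have h : Summable fun j : ℕ => ((1 + (j : ℝ)) ^ 2)⁻¹ := by
    have := (summable_nat_add_iff 1).2 (Real.summable_nat_pow_inv (p := 2) |>.2 one_lt_two)
    refine this.congr fun j => ?_
    push_cast
    ring_nf
  refine Summable.of_nat_of_neg ?_ ?_ <;> simpa using h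

theorem abs_le_norm_lat {n : ℕ} (k : Fin n → ℤ) (i : Fin n) : |(k i : ℝ)| ≤ ‖lat k‖ := by
  simpa [lat] using PiLp.norm_apply_le (lat k) i

/-- Every `|k i|` is at most `|k|`, so the summand is dominated by the product of the
one-dimensional factors `(1 + |k i|)^(-2)`. -/
theorem tsum_lattice_lt_top (n : ℕ) :
    ∑' k : Fin n → ℤ, ENNReal.ofReal (((1 + ‖lat k‖) ^ (2 * n))⁻¹) < ⊤ := by
  have h1 : ∑' j : ℤ, ENNReal.ofReal (((1 + |(j : ℝ)|) ^ 2)⁻¹) < ⊤ :=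
    summable_one_add_abs_int.tsum_ofReal_lt_top
  have h2 := tsum_pi_prod (fun j : ℤ => ENNReal.ofReal (((1 + |(j : ℝ)|) ^ 2)⁻¹)) n
  refine lt_of_le_of_lt (ENNReal.tsum_le_tsum fun k => ?_)
    (h2.trans_lt (ENNReal.pow_lt_top h1))
  rw [← ENNReal.ofReal_prod_of_nonneg fun i _ => by positivity]
  refine ENNReal.ofReal_le_ofReal ?_
  rw [Finset.prod_inv_distrib]
  refine inv_anti₀ (Finset.prod_pos fun i _ => by positivity) ?_
  calc ∏ i, (1 + |(k i : ℝ)|) ^ 2 ≤ ∏ _i : Fin n, (1 + ‖lat k‖) ^ 2 := by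
        gcongr with i
        exact abs_le_norm_lat k i
    _ = _ := by simp [pow_mul]

/-! ### Weights -/

/-- The points `y` and `x + h` are convex combinations of `x` and `y + h` with exchanged
coefficients; adding the two concavity inequalities gives the claim. -/
theorem concaveOn_add_sub_le {f : ℝ → ℝ} {τ : ℝ} (hf : ConcaveOn ℝ (Set.Ioi τ) f) {x y h : ℝ}
    (hx : τ < x) (hxy : x ≤ y) (hh : 0 ≤ h) : f (y + h) - f y ≤ f (x + h) - f x := by
  rcases eq_or_lt_of_le (show 0 ≤ y + h - x by linarith) with hL | hL
  · have h1 : y = x := by linarith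
    have h2 : h = 0 := by linarith
    simp [h1, h2]
  · have hx' : x ∈ Set.Ioi τ := hx
    have hy' : y + h ∈ Set.Ioi τ := lt_of_lt_of_le hx (by linarith)
    have hs : h / (y + h - x) + (y - x) / (y + h - x) = 1 := by
      rw [← add_div, div_eq_one_iff_eq hL.ne']
      ring
    have h1 := hf.2 hx' hy' (div_nonneg hh hL.le) (div_nonneg (sub_nonneg.2 hxy) hL.le) hs
    have h2 := hf.2 hx' hy' (div_nonneg (sub_nonneg.2 hxy) hL.le) (div_nonneg hh hL.le)
      (by rw [add_comm]; exact hs)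
    have e1 : (h / (y + h - x)) • x + ((y - x) / (y + h - x)) • (y + h) = y := by
      simp only [smul_eq_mul]
      field_simp
      ring
    have e2 : ((y - x) / (y + h - x)) • x + (h / (y + h - x)) • (y + h) = x + h := by
      simp only [smul_eq_mul]
      field_simp
      ring
    rw [e1] at h1
    rw [e2] at h2
    simp only [smul_eq_mul] at h1 h2
    have e3 : f x + f (y + h) = (h / (y + h - x) + (y - x) / (y + h - x)) * f x +
      (h / (y + h - x) + (y - x) / (y + h - x)) * f (y + h) := by
      rw [hs]
      ring
    linarith

section weight

variable {w : ℝ → ℝ}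

theorem IsWeight.exists_concaveOn (hw : IsWeight w) :
    ∃ τ, 0 ≤ τ ∧ ConcaveOn ℝ (Set.Ioi τ) w := by
  obtain ⟨τ, hτ, h⟩ := hw.concave
  refine ⟨τ, hτ, (strictConcaveOn_of_deriv2_neg' (convex_Ioi τ) ?_ fun x hx => ?_).concaveOn⟩
  · exact hw.smooth.continuousOn.mono (Set.Ioi_subset_Ioi hτ)
  · simpa [iteratedDeriv_eq_iterate] using h x hx

/-- For large `a`, concavity moves the increment of length `a + c` from `b` back to `a`, where it is
at most `w (3 a) - w a ≤ w a / 2` by slow variation. A factor below 1 in front of `w a` is what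
leaves room for polynomial gains. -/
theorem weight_add_le (hw : w ∈ weightsZero) (c : ℝ) :
    ∃ C, ∀ a b s, 0 ≤ a → a ≤ b → 0 ≤ s → s ≤ a + b + c → w s ≤ w b + w a / 2 + C := by
  obtain ⟨τ, hτ, hconc⟩ := hw.1.exists_concaveOn
  have hmono := hw.1.strictMono.monotoneOn
  have hpos : ∀ t, 0 ≤ t → 1 ≤ w t := hw.1.one_le
  obtain ⟨T, hT⟩ : ∃ T, ∀ t ≥ T, w (t * 3) / w t < 3 / 2 :=
    eventually_atTop.1 ((hw.2.2.2 3 (by norm_num)).eventually_lt_const (by norm_num))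
  -- Beyond `T` the weight is concave and `a + (a + c) ≤ 3 a`.
  obtain ⟨T, hT, hτT, hcT⟩ : ∃ T, (∀ t ≥ T, w (t * 3) / w t < 3 / 2) ∧ τ < T ∧ c ≤ T :=
    ⟨max T (max (τ + 1) c), fun t ht => hT t (le_trans (le_max_left _ _) ht),
      lt_of_lt_of_le (lt_add_one τ) ((le_max_left _ _).trans (le_max_right _ _)),
      (le_max_right _ _).trans (le_max_right _ _)⟩
  have hT0 : 0 < T := by linarith
  refine ⟨w (3 * T), fun a b s ha hab hs hsab => ?_⟩
  have hb : 0 ≤ b := ha.trans hab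
  have hwT := hpos T hT0.le
  have hw3T := hpos (3 * T) (by linarith)
  have hwa := hpos a ha
  have hwb := hpos b hb
  rcases le_total T a with hTa | hTa
  · have h1 : w (a * 3) ≤ 3 / 2 * w a := ((div_lt_iff₀ (by linarith)).1 (hT a hTa)).le
    rcases le_total (a + c) 0 with hac | hac
    · have : w s ≤ w b := hmono hs hb (by linarith)
      linarith
    have h2 := concaveOn_add_sub_le hconc (lt_of_lt_of_le hτT hTa) hab hac
    have h3 : w s ≤ w (b + (a + c)) := hmono hs (by simp; linarith) (by linarith)
    have h4 : w (a + (a + c)) ≤ w (a * 3) := hmono (by simp; linarith) (by simp; linarith)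
      (by linarith)
    linarith
  -- Here `a ≤ T`, so `s ≤ b + 2 T`; the increment is either compared with the one starting at `T`,
  -- or everything is below `3 T`.
  rcases le_total T b with hTb | hTb
  · have h2 := concaveOn_add_sub_le hconc hτT hTb (show 0 ≤ 2 * T by linarith)
    have h3 : w s ≤ w (b + 2 * T) := hmono hs (by simp; linarith) (by linarith)
    rw [show T + 2 * T = 3 * T by ring] at h2
    linarith
  · have : w s ≤ w (3 * T) := hmono hs (by simp; linarith) (by linarith)
    linarith

theorem weight_growth (hw : w ∈ weightsZero) (M : ℕ) :
    ∃ C, 0 < C ∧ ∀ t, 0 ≤ t → (1 + t) ^ M ≤ C * Real.exp (w t / 2) := by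
  -- Twice `M`, because only half of the weight is available.
  obtain ⟨T, hT⟩ := eventually_atTop.1 ((hw.1.growth (2 * M)).eventually_ge_atTop 0)
  obtain ⟨T, hT, hT1⟩ : ∃ T, (∀ t ≥ T, 0 ≤ w t - 2 * M * Real.log t) ∧ 1 ≤ T :=
    ⟨max T 1, fun t ht => hT t (le_trans (le_max_left _ _) ht), le_max_right _ _⟩
  refine ⟨(1 + T) ^ M + 2 ^ M, by positivity, fun t ht => ?_⟩
  rcases le_total t T with h | h
  · have h1 : 1 ≤ Real.exp (w t / 2) := Real.one_le_exp (by linarith [hw.1.one_le t ht])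
    calc (1 + t) ^ M ≤ (1 + T) ^ M := by gcongr
      _ ≤ (1 + T) ^ M + 2 ^ M := by linarith [show (0 : ℝ) ≤ 2 ^ M by positivity]
      _ ≤ _ := le_mul_of_one_le_right (by positivity) h1
  · have ht0 : 0 < t := by linarith
    have h1 : t ^ M ≤ Real.exp (w t / 2) := by
      rw [← Real.exp_log (pow_pos ht0 M), Real.log_pow]
      refine Real.exp_le_exp.2 ?_
      linarith [hT t h]
    calc (1 + t) ^ M ≤ (2 * t) ^ M := by
          gcongr
          linarith
      _ = 2 ^ M * t ^ M := mul_pow _ _ _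
      _ ≤ ((1 + T) ^ M + 2 ^ M) * Real.exp (w t / 2) := by
          gcongr
          linarith [show (0 : ℝ) ≤ (1 + T) ^ M by positivity]

/-- With `a` the smaller argument, one factor `e^(w a / 2)` pays for the failure of `w s ≤ w b`, the
other absorbs the power of `1 + a`. -/
theorem exp_weight_le (hw : w ∈ weightsZero) (c : ℝ) (M : ℕ) :
    ∃ C, 0 < C ∧ ∀ a b s, 0 ≤ a → 0 ≤ b → 0 ≤ s → s ≤ a + b + c →
      (1 + min a b) ^ M * Real.exp (w s) ≤ C * (Real.exp (w a) * Real.exp (w b)) := by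
  obtain ⟨C₁, h₁⟩ := weight_add_le hw c
  obtain ⟨C₂, hC₂, h₂⟩ := weight_growth hw M
  have main : ∀ a b s, 0 ≤ a → a ≤ b → 0 ≤ s → s ≤ a + b + c →
      (1 + a) ^ M * Real.exp (w s) ≤ C₂ * Real.exp C₁ * (Real.exp (w a) * Real.exp (w b)) := by
    intro a b s ha hab hs hsab
    calc (1 + a) ^ M * Real.exp (w s)
        ≤ (C₂ * Real.exp (w a / 2)) * Real.exp (w b + w a / 2 + C₁) := by
          gcongr
          · exact h₂ a ha
          · exact h₁ a b s ha hab hs hsab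
      _ = C₂ * Real.exp C₁ * ((Real.exp (w a / 2) * Real.exp (w a / 2)) * Real.exp (w b)) := by
          rw [Real.exp_add, Real.exp_add]
          ring
      _ = _ := by
          rw [← Real.exp_add, add_halves]
  refine ⟨C₂ * Real.exp C₁, by positivity, fun a b s ha hb hs hsab => ?_⟩
  rcases le_total a b with h | h
  · rw [min_eq_left h]
    exact main a b s ha h hs hsab
  · rw [min_eq_right h, mul_comm (Real.exp (w a))]
    exact main b a s hb h hs (by linarith)

end weight

/-! ### Almost convolutions of weighted sequences -/

section near

variable {n : ℕ}

/-- The frequency interactions that contribute to a product. -/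
def Near (k l m : Fin n → ℤ) : Prop := ∀ i, |k i - l i - m i| ≤ 3

instance (k l m : Fin n → ℤ) : Decidable (Near k l m) := by
  unfold Near
  infer_instance

theorem Near.symm {k l m : Fin n → ℤ} (h : Near k l m) : Near k m l := fun i => by
  rw [sub_right_comm]
  exact h i

theorem near_comm {k l m : Fin n → ℤ} : Near k l m ↔ Near k m l := ⟨Near.symm, Near.symm⟩

theorem lat_add (k l : Fin n → ℤ) : lat (k + l) = lat k + lat l := by
  ext i
  simp [lat]

theorem Near.norm_le {k l m : Fin n → ℤ} (h : Near k l m) :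
    ‖lat k‖ ≤ ‖lat l‖ + ‖lat m‖ + √(9 * n) := by
  have e : lat k = lat l + lat m + lat (k - l - m) := by
    rw [← lat_add, ← lat_add]
    congr 1
    ring
  have h3 : ‖lat (k - l - m)‖ ≤ √(9 * n) := by
    rw [EuclideanSpace.norm_eq]
    gcongr
    calc ∑ i, ‖lat (k - l - m) i‖ ^ 2 ≤ ∑ _i : Fin n, (9 : ℝ) := by
          gcongr with i
          have : |((k i - l i - m i : ℤ) : ℝ)| ≤ 3 := by exact_mod_cast h i
          have e2 : lat (k - l - m) i = ((k i - l i - m i : ℤ) : ℝ) := by simp [lat]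
          rw [e2, Real.norm_eq_abs]
          nlinarith [abs_nonneg ((k i - l i - m i : ℤ) : ℝ)]
      _ = _ := by simp [mul_comm]
  rw [e]
  exact (norm_add_le _ _).trans (add_le_add (norm_add_le _ _) h3)

/-- The number of lattice points in a cube of side `6`. -/
def nearCard (n : ℕ) : ℝ≥0∞ := ∑' i : Fin n → ℤ, if (∀ j, |i j| ≤ 3) then 1 else 0

theorem nearCard_lt_top : nearCard n < ⊤ := by
  unfold nearCard
  rw [tsum_eq_sum (s := Finset.Icc (fun _ => -3) (fun _ => 3))]
  · refine ENNReal.sum_lt_top.2 fun i _ => ?_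
    split_ifs <;> simp
  · intro i hi
    rw [if_neg]
    intro h
    refine hi (Finset.mem_Icc.2 ⟨fun j => (abs_le.1 (h j)).1, fun j => (abs_le.1 (h j)).2⟩)

/-- The inner sum over `l` makes this a genuine convolution of `g` with `a` smeared over a cube,
whose `ℓ¹` norm is `nearCard n` times that of `a`. -/
theorem ellNorm_near_le {q : ℝ≥0∞} (hq : 1 ≤ q) (a g : (Fin n → ℤ) → ℝ≥0∞) :
    ellNorm q (fun k => ∑' l, ∑' m, if Near k l m then a l * g m else 0) ≤
      nearCard n * (∑' l, a l) * ellNorm q g := by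
  have h1 : ∀ k, ∑' l, ∑' m, (if Near k l m then a l * g m else 0) =
      ∑' m, g m * ∑' l, if (∀ j, |(k - m) j - l j| ≤ 3) then a l else 0 := by
    intro k
    rw [ENNReal.tsum_comm]
    refine tsum_congr fun m => ?_
    rw [← ENNReal.tsum_mul_left]
    refine tsum_congr fun l => ?_
    have : Near k l m ↔ ∀ j, |(k - m) j - l j| ≤ 3 := near_comm
    simp only [this, mul_ite, mul_zero, mul_comm]
  have h2 : ∑' i : Fin n → ℤ, ∑' l, (if (∀ j, |i j - l j| ≤ 3) then a l else 0) =
      nearCard n * ∑' l, a l := by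
    rw [ENNReal.tsum_comm, ← ENNReal.tsum_mul_left]
    refine tsum_congr fun l => ?_
    rw [nearCard, ← ENNReal.tsum_mul_right, ← (Equiv.subRight l).tsum_eq
      (fun i : Fin n → ℤ => (if (∀ j, |i j| ≤ 3) then 1 else 0) * a l)]
    refine tsum_congr fun i => ?_
    simp
  have h3 := ellNorm_conv_le hq (fun i : Fin n → ℤ =>
    ∑' l, if (∀ j, |i j - l j| ≤ 3) then a l else 0) g
  rw [h2] at h3
  rwa [funext h1]

/-- The weight `e^{w(|k|)}`. -/
def expWeight (w : ℝ → ℝ) (k : Fin n → ℤ) : ℝ≥0∞ := ENNReal.ofReal (Real.exp (w ‖lat k‖))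

/-- The summable weight `(1+|k|)^(-2n)`. -/
def latDecay (k : Fin n → ℤ) : ℝ≥0∞ := ENNReal.ofReal (((1 + ‖lat k‖) ^ (2 * n))⁻¹)

/-- The gain in the smaller of the two frequencies is used with exponent `N + 2 n`: `N` powers yield
`R^(-N)`, the rest yields decay. Which frequency is smaller is not known, hence the sum of both
decays. -/
theorem expWeight_le {w : ℝ → ℝ} (hw : w ∈ weightsZero) (n N : ℕ) :
    ∃ C : ℝ, 0 < C ∧ ∀ R : ℝ, 0 < R → ∀ k l m : Fin n → ℤ, Near k l m →
      R ≤ 1 + ‖lat l‖ → R ≤ 1 + ‖lat m‖ → expWeight w k ≤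
        ENNReal.ofReal (C * (R ^ N)⁻¹) *
          ((latDecay l + latDecay m) * (expWeight w l * expWeight w m)) := by
  obtain ⟨C, hC, h⟩ := exp_weight_le hw (√(9 * n)) (N + 2 * n)
  refine ⟨C, hC, fun R hR k l m hk hl hm => ?_⟩
  have key := h _ _ _ (norm_nonneg _) (norm_nonneg _) (norm_nonneg _) hk.norm_le
  have hmin : R ≤ 1 + min ‖lat l‖ ‖lat m‖ := by
    rcases min_choice ‖lat l‖ ‖lat m‖ with e | e <;> rw [e] <;> assumption
  unfold expWeight latDecay
  rw [← ENNReal.ofReal_add (by positivity) (by positivity),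
    ← ENNReal.ofReal_mul (by positivity), ← ENNReal.ofReal_mul (by positivity),
    ← ENNReal.ofReal_mul (by positivity)]
  refine ENNReal.ofReal_le_ofReal ?_
  set μ := 1 + min ‖lat l‖ ‖lat m‖ with hμ
  have hμ0 : 0 < μ := hR.trans_le hmin
  have hdec : (μ ^ (2 * n))⁻¹ ≤ ((1 + ‖lat l‖) ^ (2 * n))⁻¹ + ((1 + ‖lat m‖) ^ (2 * n))⁻¹ := by
    rcases min_choice ‖lat l‖ ‖lat m‖ with e | e <;> rw [hμ, e]
    · exact le_add_of_nonneg_right (by positivity)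
    · exact le_add_of_nonneg_left (by positivity)
  calc Real.exp (w ‖lat k‖)
      = (μ ^ N)⁻¹ * (μ ^ (2 * n))⁻¹ * (μ ^ (N + 2 * n) * Real.exp (w ‖lat k‖)) := by
        rw [pow_add]
        field_simp
    _ ≤ (R ^ N)⁻¹ * (((1 + ‖lat l‖) ^ (2 * n))⁻¹ + ((1 + ‖lat m‖) ^ (2 * n))⁻¹) *
        (C * (Real.exp (w ‖lat l‖) * Real.exp (w ‖lat m‖))) := by
        gcongr
    _ = _ := by ring

theorem tsum_latDecay_mul_le {q : ℝ≥0∞} (hq : 1 ≤ q) (F : (Fin n → ℤ) → ℝ≥0∞) :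
    ∑' l, latDecay l * F l ≤ (∑' l : Fin n → ℤ, latDecay l) * ellNorm q F := by
  rw [← ENNReal.tsum_mul_right]
  gcongr with l
  exact le_ellNorm hq F l

/-- The sequence form of the product estimate. In each of the two terms of the weight bound, the
factor carrying `latDecay` goes into `ℓ¹` and the other stays in `ℓ^q`. -/
theorem ellNorm_expWeight_le {w : ℝ → ℝ} (hw : w ∈ weightsZero) {q : ℝ≥0∞} (hq : 1 ≤ q)
    (n N : ℕ) (D : ℝ≥0∞) (hD : D < ⊤) :
    ∃ C : ℝ, 0 < C ∧ ∀ R : ℝ, 0 < R → ∀ F G H : (Fin n → ℤ) → ℝ≥0∞,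
      (∀ l, F l = 0 ∨ R ≤ 1 + ‖lat l‖) → (∀ l, G l = 0 ∨ R ≤ 1 + ‖lat l‖) →
      (∀ k, H k ≤ D * ∑' l, ∑' m, if Near k l m then F l * G m else 0) →
      ellNorm q (fun k => expWeight w k * H k) ≤
        ENNReal.ofReal (C * (R ^ N)⁻¹) * ellNorm q (fun k => expWeight w k * F k) *
          ellNorm q (fun k => expWeight w k * G k) := by
  obtain ⟨C, hC, h⟩ := expWeight_le hw n N
  set B : ℝ≥0∞ := D * (2 * nearCard n * ∑' l : Fin n → ℤ, latDecay l) with hB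
  have hBtop : B < ⊤ := ENNReal.mul_lt_top hD (ENNReal.mul_lt_top
    (ENNReal.mul_lt_top (by simp) nearCard_lt_top) (tsum_lattice_lt_top n))
  -- The added 1 only keeps the constant positive when `B = 0`.
  refine ⟨C * (B.toReal + 1), by positivity, fun R hR F G H hF hG hH => ?_⟩
  set A := ENNReal.ofReal (C * (R ^ N)⁻¹) with hA
  set F' := fun k => expWeight w k * F k with hF'
  set G' := fun k => expWeight w k * G k with hG'
  have hterm : ∀ k l m : Fin n → ℤ, expWeight w k * (if Near k l m then F l * G m else 0) ≤
      A * ((if Near k l m then (latDecay l * F' l) * G' m else 0) +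
        (if Near k m l then (latDecay m * G' m) * F' l else 0)) := by
    intro k l m
    by_cases hk : Near k l m
    · rw [if_pos hk, if_pos hk, if_pos hk.symm]
      rcases hF l with h0 | hl
      · simp [h0]
      rcases hG m with h0 | hm
      · simp [h0]
      calc expWeight w k * (F l * G m)
          ≤ A * ((latDecay l + latDecay m) * (expWeight w l * expWeight w m)) * (F l * G m) := by
            gcongr
            exact h R hR k l m hk hl hm
        _ = _ := by
            simp only [hF', hG']
            ring
    · simp [hk]
  have hpt : ∀ k, expWeight w k * H k ≤ (D * A) *
      ((∑' l, ∑' m, if Near k l m then (latDecay l * F' l) * G' m else 0) +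
        (∑' m, ∑' l, if Near k m l then (latDecay m * G' m) * F' l else 0)) := by
    intro k
    calc expWeight w k * H k
        ≤ expWeight w k * (D * ∑' l, ∑' m, if Near k l m then F l * G m else 0) := by
          gcongr
          exact hH k
      _ = D * ∑' l, ∑' m, expWeight w k * (if Near k l m then F l * G m else 0) := by
          simp_rw [ENNReal.tsum_mul_left]
          ring
      _ ≤ D * ∑' l, ∑' m, A * ((if Near k l m then (latDecay l * F' l) * G' m else 0) +
            (if Near k m l then (latDecay m * G' m) * F' l else 0)) := by
          gcongr D * ?_
          exact ENNReal.tsum_le_tsum fun l => ENNReal.tsum_le_tsum fun m => hterm k l m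
      _ = _ := by
          simp_rw [ENNReal.tsum_mul_left, ENNReal.tsum_add]
          rw [ENNReal.tsum_comm (f := fun l m => if Near k m l then
            (latDecay m * G' m) * F' l else 0), mul_assoc]
  calc _ ≤ (D * A) * (nearCard n * (∑' l, latDecay l * F' l) * ellNorm q G' +
        nearCard n * (∑' l, latDecay l * G' l) * ellNorm q F') := by
        refine (ellNorm_mono hpt).trans ?_
        rw [ellNorm_const_mul hq]
        gcongr
        refine (ellNorm_add_le hq _ _).trans ?_
        gcongr
        · exact ellNorm_near_le hq _ _
        · exact ellNorm_near_le hq _ _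
    _ ≤ (D * A) * (nearCard n * ((∑' l : Fin n → ℤ, latDecay l) * ellNorm q F') * ellNorm q G' +
        nearCard n * ((∑' l : Fin n → ℤ, latDecay l) * ellNorm q G') * ellNorm q F') := by
        gcongr
        · exact tsum_latDecay_mul_le hq F'
        · exact tsum_latDecay_mul_le hq G'
    _ = B * A * ellNorm q F' * ellNorm q G' := by
        rw [hB]
        ring
    _ ≤ _ := by
        gcongr
        have h0 : 0 ≤ C * (R ^ N)⁻¹ := by positivity
        calc B * A = ENNReal.ofReal (B.toReal * (C * (R ^ N)⁻¹)) := by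
              rw [ENNReal.ofReal_mul ENNReal.toReal_nonneg, ENNReal.ofReal_toReal hBtop.ne]
          _ ≤ _ := by
              refine ENNReal.ofReal_le_ofReal ?_
              linarith

end near

/-! ### The rescaled Fourier transform on Schwartz functions -/

section fourier

variable {n : ℕ}

/-- The normalizing constant `(2π)^(-n/2)`. -/
def fconst (n : ℕ) : ℂ := (((2 * Real.pi) ^ (-(n : ℝ) / 2) : ℝ) : ℂ)

theorem fconst_mul_self (n : ℕ) : fconst n * fconst n * ((2 * Real.pi) ^ n : ℝ) = 1 := by
  unfold fconst
  rw [← Complex.ofReal_mul, ← Complex.ofReal_mul, ← Real.rpow_natCast,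
    ← Real.rpow_add Real.two_pi_pos, ← Real.rpow_add Real.two_pi_pos,
    show -(n : ℝ) / 2 + -(n : ℝ) / 2 + n = 0 by ring, Real.rpow_zero, Complex.ofReal_one]

theorem integral_comp_inv_two_pi (F : E n → ℂ) :
    ∫ v, F ((2 * Real.pi)⁻¹ • v) = ((2 * Real.pi) ^ n : ℝ) * ∫ v, F v := by
  rw [Measure.integral_comp_smul]
  simp only [finrank_euclideanSpace, Fintype.card_fin, inv_pow, inv_inv]
  rw [abs_of_pos (by positivity), Complex.real_smul]

/-- Inversion for the `2π`-in-the-exponent normalization, rescaled: the Jacobian `(2π)^n` of the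
dilation cancels the two normalizing constants. -/
theorem schwartzFourierInv_schwartzFourier (φ : 𝓢(E n, ℂ)) :
    schwartzFourierInv n (schwartzFourier n φ) = φ := by
  ext x
  change fconst n * (𝓕⁻ (schwartzFourier n φ)) ((2 * Real.pi)⁻¹ • x) = _
  rw [SchwartzMap.fourierInv_coe, Real.fourierInv_eq]
  have h : ∀ v, (schwartzFourier n φ) v = fconst n * (𝓕 φ : 𝓢(E n, ℂ)) ((2 * Real.pi)⁻¹ • v) := fun v => rfl
  simp_rw [h, inner_smul_right, ← real_inner_smul_left]
  rw [integral_comp_inv_two_pi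
    (fun v => Real.fourierChar (inner ℝ v x) • (fconst n * (𝓕 φ : 𝓢(E n, ℂ)) v))]
  have h2 : ∫ v, Real.fourierChar (inner ℝ v x) • (fconst n * (𝓕 φ : 𝓢(E n, ℂ)) v) = fconst n * φ x := by
    conv_rhs => rw [← FourierTransform.fourierInv_fourier_eq (F := 𝓢(E n, ℂ)) φ, SchwartzMap.fourierInv_coe,
      Real.fourierInv_eq, ← integral_const_mul]
    refine integral_congr_ae (.of_forall fun v => ?_)
    simp only [Circle.smul_def, smul_eq_mul]
    ring
  rw [h2]
  linear_combination φ x * fconst_mul_self n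

theorem schwartzFourier_schwartzFourierInv (φ : 𝓢(E n, ℂ)) :
    schwartzFourier n (schwartzFourierInv n φ) = φ := by
  ext x
  change fconst n * (𝓕 (schwartzFourierInv n φ)) ((2 * Real.pi)⁻¹ • x) = _
  rw [SchwartzMap.fourier_coe, Real.fourier_eq]
  have h : ∀ v, (schwartzFourierInv n φ) v = fconst n * (𝓕⁻ φ : 𝓢(E n, ℂ)) ((2 * Real.pi)⁻¹ • v) :=
    fun v => rfl
  simp_rw [h, inner_smul_right, ← real_inner_smul_left]
  rw [integral_comp_inv_two_pi
    (fun v => Real.fourierChar (-inner ℝ v x) • (fconst n * (𝓕⁻ φ : 𝓢(E n, ℂ)) v))]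
  have h2 : ∫ v, Real.fourierChar (-inner ℝ v x) • (fconst n * (𝓕⁻ φ : 𝓢(E n, ℂ)) v) = fconst n * φ x := by
    conv_rhs => rw [← FourierTransform.fourier_fourierInv_eq (F := 𝓢(E n, ℂ)) φ, SchwartzMap.fourier_coe,
      Real.fourier_eq, ← integral_const_mul]
    refine integral_congr_ae (.of_forall fun v => ?_)
    simp only [Circle.smul_def, smul_eq_mul]
    ring
  rw [h2]
  linear_combination φ x * fconst_mul_self n

theorem integral_mul_integral_swap {A B : E n → ℂ} {e : E n → E n → ℂ} (hA : Integrable A)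
    (hB : Integrable B) (he : Continuous (Function.uncurry e)) (he1 : ∀ x y, ‖e x y‖ ≤ 1) :
    ∫ x, A x * ∫ y, e x y * B y = ∫ y, B y * ∫ x, e x y * A x := by
  have hint : Integrable (Function.uncurry fun x y => e x y * (A x * B y))
      (volume.prod volume) :=
    (hA.mul_prod hB).bdd_mul he.aestronglyMeasurable (.of_forall fun z => he1 z.1 z.2)
  calc ∫ x, A x * ∫ y, e x y * B y = ∫ x, ∫ y, e x y * (A x * B y) := by
        simp_rw [← integral_const_mul]
        congr! 4
        ring
    _ = ∫ y, ∫ x, e x y * (A x * B y) := integral_integral_swap hint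
    _ = _ := by
        simp_rw [← integral_const_mul]
        congr! 4
        ring

theorem norm_exp_I_mul (t : ℝ) : ‖Complex.exp (Complex.I * t)‖ = 1 := by
  rw [mul_comm]
  exact Complex.norm_exp_ofReal_mul_I t

theorem norm_exp_neg_I_mul (t : ℝ) : ‖Complex.exp (-Complex.I * t)‖ = 1 := by
  have := norm_exp_I_mul (-t)
  rwa [Complex.ofReal_neg, mul_neg, ← neg_mul] at this

/-- Pointwise multiplication of Schwartz functions. -/
abbrev mulS (χ φ : 𝓢(E n, ℂ)) : 𝓢(E n, ℂ) := SchwartzMap.smulLeftCLM ℂ (χ : E n → ℂ) φ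

theorem mulS_apply (χ φ : 𝓢(E n, ℂ)) (x : E n) : mulS χ φ x = χ x * φ x := by
  simp [mulS, χ.hasTemperateGrowth]

/-- This is the transpose of the multiplier with symbol `χ`, acting on test functions; it explains
the kernel chosen for `op`. -/
theorem schwartzFourier_mulS (χ φ : 𝓢(E n, ℂ)) (x : E n) :
    schwartzFourier n (mulS χ (schwartzFourierInv n φ)) x =
      fconst n * ∫ y, φ y * schwartzFourier n χ (x - y) := by
  rw [schwartzFourier_apply]
  change fconst n * _ = _
  congr 1
  have h := integral_mul_integral_swap (A := χ) (B := φ)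
    (e := fun ξ y => Complex.exp (-Complex.I * (inner ℝ ξ x : ℝ)) *
      Complex.exp (Complex.I * (inner ℝ y ξ : ℝ))) χ.integrable φ.integrable
    (by unfold Function.uncurry; fun_prop)
    (fun ξ y => by rw [norm_mul, norm_exp_I_mul, norm_exp_neg_I_mul, one_mul])
  calc _ = fconst n * ∫ ξ, χ ξ * ∫ y, Complex.exp (-Complex.I * (inner ℝ ξ x : ℝ)) *
      Complex.exp (Complex.I * (inner ℝ y ξ : ℝ)) * φ y := by
        rw [← integral_const_mul]
        refine integral_congr_ae (.of_forall fun ξ => ?_)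
        simp only [mulS_apply, schwartzFourierInv_apply, mul_assoc]
        rw [integral_const_mul]
        change _ * (_ * (fconst n * _)) = _
        ring
    _ = _ := by
        rw [h, ← integral_const_mul]
        refine integral_congr_ae (.of_forall fun y => ?_)
        simp only [schwartzFourier_apply]
        change _ = _ * (fconst n * _)
        rw [mul_left_comm]
        congr 3
        ext ξ
        rw [← Complex.exp_add, inner_sub_right, real_inner_comm ξ y]
        push_cast
        ring_nf

/-- The Schwartz function `x ↦ φ (s - x)`. -/
def reflectS (s : E n) (φ : 𝓢(E n, ℂ)) : 𝓢(E n, ℂ) :=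
  SchwartzMap.compSubConstCLM ℂ s
    (SchwartzMap.compCLMOfContinuousLinearEquiv ℂ (ContinuousLinearEquiv.neg ℝ) φ)

theorem reflectS_apply (s : E n) (φ : 𝓢(E n, ℂ)) (x : E n) : reflectS s φ x = φ (s - x) := by
  simp [reflectS]

/-- The right side sees `ψ` only at `ζ + η` with `η` in the support of `χ`, and `s` enters only
through a phase. So the left side is supported in `supp ψ - supp χ`, uniformly in `s`. -/
theorem schwartzFourierInv_mulS_reflectS (χ ψ : 𝓢(E n, ℂ)) (s ζ : E n) :
    schwartzFourierInv n (mulS (reflectS s (schwartzFourier n χ)) (schwartzFourier n ψ)) ζ =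
      fconst n * ∫ η, χ η * (Complex.exp (-Complex.I * (inner ℝ η s : ℝ)) * ψ (ζ + η)) := by
  rw [schwartzFourierInv_apply]
  change fconst n * _ = _
  congr 1
  have h := integral_mul_integral_swap (A := schwartzFourier n ψ) (B := χ)
    (e := fun x η => Complex.exp (Complex.I * (inner ℝ x ζ : ℝ)) *
      Complex.exp (-Complex.I * (inner ℝ η (s - x) : ℝ))) (SchwartzMap.integrable _) χ.integrable
    (by unfold Function.uncurry; fun_prop)
    (fun x η => by rw [norm_mul, norm_exp_I_mul, norm_exp_neg_I_mul, one_mul])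
  calc _ = fconst n * ∫ x, schwartzFourier n ψ x *
      ∫ η, Complex.exp (Complex.I * (inner ℝ x ζ : ℝ)) *
        Complex.exp (-Complex.I * (inner ℝ η (s - x) : ℝ)) * χ η := by
        rw [← integral_const_mul]
        refine integral_congr_ae (.of_forall fun x => ?_)
        simp only [mulS_apply, reflectS_apply, mul_assoc]
        rw [integral_const_mul, schwartzFourier_apply χ]
        change _ * ((fconst n * _) * _) = _
        ring
    _ = _ := by
        rw [h, ← integral_const_mul]
        refine integral_congr_ae (.of_forall fun η => ?_)
        dsimp only
        conv_rhs => rw [← schwartzFourierInv_schwartzFourier ψ, schwartzFourierInv_apply]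
        change _ = _ * (_ * (fconst n * _))
        rw [mul_left_comm (Complex.exp _), mul_left_comm (χ η)]
        congr 2
        rw [← integral_const_mul]
        refine integral_congr_ae (.of_forall fun x => ?_)
        beta_reduce
        rw [← mul_assoc, ← Complex.exp_add, ← Complex.exp_add, inner_sub_right, inner_add_right,
          real_inner_comm x η]
        push_cast
        ring_nf

end fourier

/-! ### Compactly supported functions are dense in the Schwartz space -/

section density

variable {n : ℕ}

theorem exists_cutoff (n : ℕ) : ∃ η : 𝓢(E n, ℂ), HasCompactSupport η ∧
    ∀ x, ‖x‖ ≤ 1 → η x = 1 := by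
  let b : ContDiffBump (0 : E n) := ⟨1, 2, one_pos, one_lt_two⟩
  have h1 : HasCompactSupport (Complex.ofRealCLM ∘ b) := b.hasCompactSupport.comp_left rfl
  have h2 : ContDiff ℝ ∞ (Complex.ofRealCLM ∘ b) := Complex.ofRealCLM.contDiff.comp b.contDiff
  refine ⟨h1.toSchwartzMap h2, h1, fun x hx => ?_⟩
  have : b x = 1 := b.one_of_mem_closedBall (by simpa using hx)
  simp [this]

/-- Dilation by a real number. -/
def scaleCLM (n : ℕ) (r : ℝ) : E n →L[ℝ] E n := r • ContinuousLinearMap.id ℝ (E n)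

/-- Each derivative of a dilate by `r ≤ 1` gains a factor `r`, so the bound is uniform in `r`. -/
theorem norm_iteratedFDeriv_one_sub_le (η : 𝓢(E n, ℂ)) (i : ℕ) :
    ∃ C, ∀ r : ℝ, 0 ≤ r → r ≤ 1 → ∀ x,
      ‖iteratedFDeriv ℝ i (fun y => 1 - η (scaleCLM n r y)) x‖ ≤ C := by
  refine ⟨1 + SchwartzMap.seminorm ℝ 0 i η, fun r hr0 hr1 x => ?_⟩
  have hs : ContDiff ℝ i (η ∘ scaleCLM n r) := (η.smooth i).comp (scaleCLM n r).contDiff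
  have e : (fun y => 1 - η (scaleCLM n r y)) = (fun _ => (1 : ℂ)) - η ∘ scaleCLM n r := rfl
  rw [e, iteratedFDeriv_sub_apply contDiff_const.contDiffAt hs.contDiffAt]
  refine (norm_sub_le _ _).trans (add_le_add ?_ ?_)
  · rcases i with _ | i
    · simp
    · rw [iteratedFDeriv_const_of_ne (by simp)]
      simp
  · rw [(scaleCLM n r).iteratedFDeriv_comp_right (η.smooth i) x le_rfl]
    refine (ContinuousMultilinearMap.norm_compContinuousLinearMap_le _ _).trans ?_
    have h1 : ‖scaleCLM n r‖ ≤ 1 := by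
      unfold scaleCLM
      rw [norm_smul, Real.norm_of_nonneg hr0]
      exact mul_le_one₀ hr1 (norm_nonneg _) ContinuousLinearMap.norm_id_le
    calc _ ≤ SchwartzMap.seminorm ℝ 0 i η * 1 := by
          gcongr
          · exact SchwartzMap.norm_iteratedFDeriv_le_seminorm ℝ η i _
          · exact Finset.prod_le_one (fun _ _ => norm_nonneg _) fun _ _ => h1
      _ = _ := mul_one _

/-- The error `(1 - η (r x)) φ x` vanishes where `‖x‖ r < 1`; elsewhere `1 ≤ ‖x‖ r` trades one more
power of `‖x‖`, controlled by a higher seminorm of `φ`, for a factor `r`. -/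
theorem exists_tendsto_hasCompactSupport (φ : 𝓢(E n, ℂ)) :
    ∃ φs : ℕ → 𝓢(E n, ℂ), (∀ j, HasCompactSupport (φs j)) ∧ Tendsto φs atTop (𝓝 φ) := by
  obtain ⟨η, hηc, hη1⟩ := exists_cutoff n
  set r : ℕ → ℝ := fun j => 1 / ((j : ℝ) + 1) with hr
  have hr0 : ∀ j, 0 < r j := fun j => by positivity
  have hr1 : ∀ j, r j ≤ 1 := fun j => by
    rw [hr, div_le_one (by positivity)]
    linarith [show (0 : ℝ) ≤ j by positivity]
  have hcs : ∀ j, HasCompactSupport (η ∘ scaleCLM n (r j)) := fun j =>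
    hηc.comp_homeomorph (Homeomorph.smulOfNeZero (r j) (hr0 j).ne')
  have hcd : ∀ j, ContDiff ℝ ∞ (η ∘ scaleCLM n (r j)) := fun j =>
    (η.smooth ⊤).comp (scaleCLM n (r j)).contDiff
  set ηs : ℕ → 𝓢(E n, ℂ) := fun j => (hcs j).toSchwartzMap (hcd j) with hηs
  have hηs_apply : ∀ j x, ηs j x = η (scaleCLM n (r j) x) := fun j x => rfl
  refine ⟨fun j => mulS (ηs j) φ, fun j => ?_, ?_⟩
  · have : (mulS (ηs j) φ : E n → ℂ) = fun x => ηs j x * φ x := funext (mulS_apply _ _)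
    rw [this]
    exact (hcs j).mul_right
  · rw [(schwartz_withSeminorms ℝ (E n) ℂ).tendsto_nhds _ φ]
    rintro ⟨k, m⟩ ε hε
    choose C hC using norm_iteratedFDeriv_one_sub_le η
    set K : ℝ := ∑ i ∈ Finset.range (m + 1), (m.choose i : ℝ) * C i *
      SchwartzMap.seminorm ℝ (k + 1) (m - i) φ with hK
    have hC0 : ∀ i, 0 ≤ C i := fun i => (norm_nonneg _).trans (hC i 0 le_rfl zero_le_one 0)
    have hK0 : 0 ≤ K := Finset.sum_nonneg fun i _ =>
      mul_nonneg (mul_nonneg (by positivity) (hC0 i)) (apply_nonneg _ _)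
    have hbound : ∀ j, SchwartzMap.seminorm ℝ k m (mulS (ηs j) φ - φ) ≤ K * r j := by
      intro j
      refine SchwartzMap.seminorm_le_bound ℝ k m _ (mul_nonneg hK0 (hr0 j).le) fun x => ?_
      set G : E n → ℂ := fun y => 1 - η (scaleCLM n (r j) y) with hG
      have hfun : (mulS (ηs j) φ - φ : 𝓢(E n, ℂ)) = fun y => -(G y * φ y) := by
        ext y
        simp only [sub_apply, mulS_apply, hηs_apply, hG]
        ring
      rw [hfun]
      rcases lt_or_ge (‖x‖ * r j) 1 with hx | hx
      · have hz : (fun y => -(G y * φ y)) =ᶠ[𝓝 x] fun _ => 0 := by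
          have : ∀ᶠ y in 𝓝 x, ‖y‖ * r j < 1 :=
            (continuous_norm.mul continuous_const).continuousAt.eventually_lt_const hx
          filter_upwards [this] with y hy
          have : G y = 0 := by
            rw [hG]
            dsimp only
            rw [hη1 _ (by simpa [scaleCLM, norm_smul, abs_of_pos (hr0 j), mul_comm] using hy.le),
              sub_self]
          simp [this]
        have hz' : iteratedFDeriv ℝ m (fun y => -(G y * φ y)) x =
            iteratedFDeriv ℝ m (fun _ => (0 : ℂ)) x := (hz.iteratedFDeriv ℝ m).eq_of_nhds
        rw [hz']
        simp only [iteratedFDeriv_fun_zero, Pi.zero_apply, norm_zero, mul_zero]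
        exact mul_nonneg hK0 (hr0 j).le
      · have hGd : ContDiff ℝ m G :=
          contDiff_const.sub ((η.smooth m).comp (scaleCLM n (r j)).contDiff)
        have e1 : ‖iteratedFDeriv ℝ m (fun y => -(G y * φ y)) x‖ =
            ‖iteratedFDeriv ℝ m (fun y => G y * φ y) x‖ := by
          rw [show (fun y => -(G y * φ y)) = -(fun y => G y * φ y) from rfl,
            iteratedFDeriv_neg_apply, norm_neg]
        rw [e1]
        calc ‖x‖ ^ k * ‖iteratedFDeriv ℝ m (fun y => G y * φ y) x‖
            ≤ ‖x‖ ^ k * ∑ i ∈ Finset.range (m + 1), (m.choose i : ℝ) *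
                ‖iteratedFDeriv ℝ i G x‖ * ‖iteratedFDeriv ℝ (m - i) φ x‖ := by
              gcongr
              exact norm_iteratedFDeriv_mul_le hGd (φ.smooth m) x le_rfl
          _ ≤ (‖x‖ ^ k * ∑ i ∈ Finset.range (m + 1), (m.choose i : ℝ) * C i *
                ‖iteratedFDeriv ℝ (m - i) φ x‖) * (‖x‖ * r j) := by
              have h0 : 0 ≤ ‖x‖ ^ k * ∑ i ∈ Finset.range (m + 1), (m.choose i : ℝ) *
                ‖iteratedFDeriv ℝ i G x‖ * ‖iteratedFDeriv ℝ (m - i) φ x‖ := by positivity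
              have h1 : ‖x‖ ^ k * ∑ i ∈ Finset.range (m + 1), (m.choose i : ℝ) *
                  ‖iteratedFDeriv ℝ i G x‖ * ‖iteratedFDeriv ℝ (m - i) φ x‖ ≤
                  ‖x‖ ^ k * ∑ i ∈ Finset.range (m + 1), (m.choose i : ℝ) * C i *
                  ‖iteratedFDeriv ℝ (m - i) φ x‖ := by
                gcongr with i
                exact hC i (r j) (hr0 j).le (hr1 j) x
              exact h1.trans (le_mul_of_one_le_right (h0.trans h1) hx)
          _ = (∑ i ∈ Finset.range (m + 1), (m.choose i : ℝ) * C i *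
                (‖x‖ ^ (k + 1) * ‖iteratedFDeriv ℝ (m - i) φ x‖)) * r j := by
              rw [Finset.mul_sum, Finset.sum_mul, Finset.sum_mul]
              refine Finset.sum_congr rfl fun i _ => ?_
              ring
          _ ≤ K * r j := by
              refine mul_le_mul_of_nonneg_right (Finset.sum_le_sum fun i _ => ?_) (hr0 j).le
              refine mul_le_mul_of_nonneg_left ?_ (mul_nonneg (by positivity) (hC0 i))
              exact SchwartzMap.le_seminorm ℝ (k + 1) (m - i) φ x
    have hlim : Tendsto (fun j => K * r j) atTop (𝓝 0) := by
      have := (tendsto_one_div_add_atTop_nhds_zero_nat (𝕜 := ℝ)).const_mul K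
      rwa [mul_zero] at this
    filter_upwards [hlim.eventually_lt_const hε] with j hj
    exact (hbound j).trans_lt hj

theorem eq_of_eq_on_hasCompactSupport {F₁ F₂ : 𝓢(E n, ℂ) → ℂ} (h₁ : Continuous F₁)
    (h₂ : Continuous F₂) (h : ∀ φ : 𝓢(E n, ℂ), HasCompactSupport φ → F₁ φ = F₂ φ) : F₁ = F₂ := by
  ext φ
  obtain ⟨φs, hc, hφ⟩ := exists_tendsto_hasCompactSupport φ
  refine tendsto_nhds_unique ((h₁.tendsto φ).comp hφ) (((h₂.tendsto φ).comp hφ).congr fun j => ?_)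
  exact (h _ (hc j)).symm

end density

/-! ### Frequency multipliers acting on `Lᵖ` functions -/

section op

variable {n : ℕ}

/-- The pairing of a function with a Schwartz function. -/
def pair (f : E n → ℂ) (φ : 𝓢(E n, ℂ)) : ℂ := ∫ x, φ x * f x

/-- The Fourier multiplier with symbol `χ`, as a convolution operator. -/
def op (χ : 𝓢(E n, ℂ)) (f : E n → ℂ) (y : E n) : ℂ :=
  fconst n * ∫ x, f x * schwartzFourier n χ (x - y)

variable {p r : ℝ≥0∞}

theorem toDist_apply [Fact (1 ≤ p)] {f : E n → ℂ} (hf : MemLp f p volume) (φ : 𝓢(E n, ℂ)) :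
    toDist p f φ = pair f φ := by
  rw [toDist, dif_pos hf, Lp.toTemperedDistribution_apply]
  refine integral_congr_ae ?_
  filter_upwards [hf.coeFn_toLp] with x hx
  rw [hx, smul_eq_mul]

theorem pair_congr_ae {f g : E n → ℂ} (h : f =ᵐ[volume] g) (φ : 𝓢(E n, ℂ)) :
    pair f φ = pair g φ := by
  refine integral_congr_ae ?_
  filter_upwards [h] with x hx
  rw [hx]

theorem ae_eq_of_pair_eq (hp : 1 ≤ p) (hr : 1 ≤ r) {f g : E n → ℂ} (hf : MemLp f p volume)
    (hg : MemLp g r volume) (h : ∀ φ : 𝓢(E n, ℂ), HasCompactSupport φ → pair f φ = pair g φ) :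
    f =ᵐ[volume] g := by
  refine ae_eq_of_integral_contDiff_smul_eq (hf.locallyIntegrable hp) (hg.locallyIntegrable hr)
    fun φ hφ hc => ?_
  have hc' : HasCompactSupport (Complex.ofRealCLM ∘ φ) := hc.comp_left rfl
  have hφ' : ContDiff ℝ ∞ (Complex.ofRealCLM ∘ φ) := by fun_prop
  simpa [pair] using h (hc'.toSchwartzMap hφ') hc'

theorem continuous_pair (hp : 1 ≤ p) {f : E n → ℂ} (hf : MemLp f p volume) :
    Continuous (pair f) := by
  have : Fact (1 ≤ p) := ⟨hp⟩
  have : pair f = fun φ => toDist p f φ := funext fun φ => (toDist_apply hf φ).symm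
  rw [this]
  exact (toDist p f).continuous

theorem integrable_mul_schwartz (hp : 1 ≤ p) {f : E n → ℂ} (hf : MemLp f p volume)
    (φ : 𝓢(E n, ℂ)) : Integrable (fun x => f x * φ x) := by
  -- `(1 - p⁻¹)⁻¹` is the conjugate exponent, with the conventions of `ℝ≥0∞` giving `⊤` at `p = 1`
  -- and `1` at `p = ⊤`.
  have := ENNReal.HolderConjugate.inv_one_sub_inv' hp
  exact hf.integrable_mul (φ.memLp (1 - p⁻¹)⁻¹ volume)

theorem pair_add (hp : 1 ≤ p) {f g : E n → ℂ} (hf : MemLp f p volume) (hg : MemLp g p volume)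
    (φ : 𝓢(E n, ℂ)) : pair (f + g) φ = pair f φ + pair g φ := by
  simp only [pair, mul_comm (φ _), Pi.add_apply, add_mul]
  exact integral_add (integrable_mul_schwartz hp hf φ) (integrable_mul_schwartz hp hg φ)

theorem pair_smul (c : ℂ) (f : E n → ℂ) (φ : 𝓢(E n, ℂ)) : pair (c • f) φ = c * pair f φ := by
  simp only [pair, Pi.smul_apply, smul_eq_mul, mul_left_comm _ c]
  exact integral_const_mul _ _

theorem eLpNorm_schwartz_sub (φ : 𝓢(E n, ℂ)) (y : E n) :
    eLpNorm (fun x => φ (x - y)) p volume = eLpNorm φ p volume :=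
  eLpNorm_comp_measurePreserving φ.continuous.aestronglyMeasurable
    (measurePreserving_sub_right volume y)

theorem eLpNorm_one_mul_shift_le (hp : 1 ≤ p) {f : E n → ℂ} (hf : AEStronglyMeasurable f volume)
    (φ : 𝓢(E n, ℂ)) (y : E n) :
    eLpNorm (fun x => f x * φ (x - y)) 1 volume ≤
      eLpNorm f p volume * eLpNorm φ (1 - p⁻¹)⁻¹ volume := by
  have := ENNReal.HolderConjugate.inv_one_sub_inv' hp
  have hφ : AEStronglyMeasurable (fun x => φ (x - y)) volume :=
    (φ.continuous.comp (continuous_id.sub continuous_const)).aestronglyMeasurable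
  have h := eLpNorm_smul_le_mul_eLpNorm (p := p) (q := (1 - p⁻¹)⁻¹) (r := 1) hφ hf
  rw [eLpNorm_schwartz_sub φ y] at h
  exact h

theorem integrable_mul_shift (hp : 1 ≤ p) {f : E n → ℂ} (hf : MemLp f p volume)
    (φ : 𝓢(E n, ℂ)) (y : E n) : Integrable (fun x => f x * φ (x - y)) :=
  memLp_one_iff_integrable.1 ⟨hf.1.mul (by fun_prop),
    (eLpNorm_one_mul_shift_le hp hf.1 φ y).trans_lt
      (ENNReal.mul_lt_top hf.2 (φ.eLpNorm_lt_top _ volume))⟩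

theorem aestronglyMeasurable_mul_shift {f : E n → ℂ} (hf : AEStronglyMeasurable f volume)
    (φ : 𝓢(E n, ℂ)) : AEStronglyMeasurable (fun z : E n × E n => f z.2 * φ (z.2 - z.1))
      (volume.prod volume) := by
  refine (hf.comp_snd).mul ?_
  fun_prop

theorem aestronglyMeasurable_op {f : E n → ℂ} (hf : AEStronglyMeasurable f volume)
    (χ : 𝓢(E n, ℂ)) : AEStronglyMeasurable (op χ f) volume :=
  (aestronglyMeasurable_mul_shift hf _).integral_prod_right'.const_mul _

theorem enorm_op_le (χ : 𝓢(E n, ℂ)) (f : E n → ℂ) (y : E n) :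
    ‖op χ f y‖ₑ ≤ ‖fconst n‖ₑ * ∫⁻ x, ‖f x‖ₑ * ‖schwartzFourier n χ (x - y)‖ₑ := by
  unfold op
  rw [enorm_mul]
  gcongr
  refine (enorm_integral_le_lintegral_enorm _).trans_eq ?_
  simp only [enorm_mul]

theorem eLpNorm_op_top_le (hp : 1 ≤ p) {f : E n → ℂ} (hf : AEStronglyMeasurable f volume)
    (χ : 𝓢(E n, ℂ)) : eLpNorm (op χ f) ⊤ volume ≤
      ‖fconst n‖ₑ * eLpNorm (schwartzFourier n χ) (1 - p⁻¹)⁻¹ volume * eLpNorm f p volume := by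
  rw [eLpNorm_exponent_top]
  refine eLpNormEssSup_le_of_ae_enorm_bound (.of_forall fun y => (enorm_op_le χ f y).trans ?_)
  rw [mul_assoc, mul_comm (eLpNorm _ _ _)]
  gcongr
  have := eLpNorm_one_mul_shift_le hp hf (schwartzFourier n χ) y
  simpa [eLpNorm_one_eq_lintegral_enorm, enorm_mul] using this

theorem eLpNorm_op_le (hp : 1 ≤ p) {f : E n → ℂ} (hf : AEStronglyMeasurable f volume)
    (χ : 𝓢(E n, ℂ)) : eLpNorm (op χ f) p volume ≤
      ‖fconst n‖ₑ * eLpNorm (schwartzFourier n χ) 1 volume * eLpNorm f p volume := by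
  by_cases hpt : p = ⊤
  · subst hpt
    -- At `p = ⊤` the conjugate exponent is 1, so the Hölder bound is the required one.
    simpa using eLpNorm_op_top_le le_top hf χ
  have hp0 : p ≠ 0 := (zero_lt_one.trans_le hp).ne'
  have hpr : 0 < p.toReal := toReal_pos_of_one_le hp hpt
  have key := lintegral_young volume (one_le_toReal hp hpt) (f := fun x => ‖f x‖ₑ)
    (k := fun x => ‖schwartzFourier n χ x‖ₑ) hf.enorm
    (schwartzFourier n χ).continuous.measurable.enorm
  rw [eLpNorm_eq_lintegral_rpow_enorm_toReal hp0 hpt, eLpNorm_eq_lintegral_rpow_enorm_toReal hp0 hpt,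
    eLpNorm_one_eq_lintegral_enorm]
  calc (∫⁻ y, ‖op χ f y‖ₑ ^ p.toReal) ^ (1 / p.toReal)
      ≤ (∫⁻ y, ‖fconst n‖ₑ ^ p.toReal *
          (∫⁻ x, ‖f x‖ₑ * ‖schwartzFourier n χ (x - y)‖ₑ) ^ p.toReal) ^ (1 / p.toReal) := by
        gcongr with y
        rw [← ENNReal.mul_rpow_of_nonneg _ _ hpr.le]
        gcongr
        exact enorm_op_le χ f y
    _ ≤ (‖fconst n‖ₑ ^ p.toReal * ((∫⁻ x, ‖schwartzFourier n χ x‖ₑ) ^ p.toReal *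
          ∫⁻ x, ‖f x‖ₑ ^ p.toReal)) ^ (1 / p.toReal) := by
        rw [lintegral_const_mul' _ _ (by simp)]
        gcongr
    _ = _ := by
        rw [← mul_assoc, ← ENNReal.mul_rpow_of_nonneg _ _ hpr.le,
          ENNReal.mul_rpow_of_nonneg _ _ (by positivity), ← ENNReal.rpow_mul,
          mul_one_div_cancel hpr.ne', ENNReal.rpow_one]

theorem memLp_op (hp : 1 ≤ p) {f : E n → ℂ} (hf : MemLp f p volume) (χ : 𝓢(E n, ℂ)) :
    MemLp (op χ f) p volume :=
  ⟨aestronglyMeasurable_op hf.1 χ, (eLpNorm_op_le hp hf.1 χ).trans_lt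
    (ENNReal.mul_lt_top (ENNReal.mul_lt_top enorm_lt_top
      ((schwartzFourier n χ).eLpNorm_lt_top _ volume)) hf.2)⟩

theorem memLp_op_top (hp : 1 ≤ p) {f : E n → ℂ} (hf : MemLp f p volume) (χ : 𝓢(E n, ℂ)) :
    MemLp (op χ f) ⊤ volume :=
  ⟨aestronglyMeasurable_op hf.1 χ, (eLpNorm_op_top_le hp hf.1 χ).trans_lt
    (ENNReal.mul_lt_top (ENNReal.mul_lt_top enorm_lt_top
      ((schwartzFourier n χ).eLpNorm_lt_top _ volume)) hf.2)⟩

theorem op_add (hp : 1 ≤ p) {f g : E n → ℂ} (hf : MemLp f p volume) (hg : MemLp g p volume)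
    (χ : 𝓢(E n, ℂ)) : op χ (f + g) = op χ f + op χ g := by
  ext y
  simp only [op, Pi.add_apply, add_mul, ← mul_add]
  rw [integral_add (integrable_mul_shift hp hf _ y) (integrable_mul_shift hp hg _ y)]

theorem op_smul (c : ℂ) (f : E n → ℂ) (χ : 𝓢(E n, ℂ)) : op χ (c • f) = c • op χ f := by
  ext y
  simp only [op, Pi.smul_apply, smul_eq_mul, mul_assoc]
  rw [integral_const_mul]
  ring

/-- Fubini's theorem for a function of `Lᵖ`, convolved with a Schwartz function and integrated
against an integrable function. -/
theorem integrable_conv_mul (hp : 1 ≤ p) {f : E n → ℂ} (hf : MemLp f p volume) (K : 𝓢(E n, ℂ))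
    {g : E n → ℂ} (hg : Integrable g) :
    Integrable (fun z : E n × E n => g z.1 * (f z.2 * K (z.2 - z.1))) (volume.prod volume) := by
  have hm : AEStronglyMeasurable (fun z : E n × E n => g z.1 * (f z.2 * K (z.2 - z.1)))
      (volume.prod volume) := hg.1.comp_fst.mul (aestronglyMeasurable_mul_shift hf.1 K)
  refine ⟨hm, ?_⟩
  rw [hasFiniteIntegral_iff_enorm, lintegral_prod _ hm.enorm]
  calc ∫⁻ y, ∫⁻ x, ‖g y * (f x * K (x - y))‖ₑ
      = ∫⁻ y, ‖g y‖ₑ * ∫⁻ x, ‖f x * K (x - y)‖ₑ := by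
        congr! 2 with y
        simp only [enorm_mul (g y)]
        rw [lintegral_const_mul' _ _ enorm_ne_top]
    _ ≤ ∫⁻ y, ‖g y‖ₑ * (eLpNorm f p volume * eLpNorm K (1 - p⁻¹)⁻¹ volume) := by
        gcongr with y
        have := eLpNorm_one_mul_shift_le hp hf.1 K y
        rwa [eLpNorm_one_eq_lintegral_enorm] at this
    _ = (∫⁻ y, ‖g y‖ₑ) * (eLpNorm f p volume * eLpNorm K (1 - p⁻¹)⁻¹ volume) :=
        lintegral_mul_const' _ _ (ENNReal.mul_lt_top hf.2 (K.eLpNorm_lt_top _ volume)).ne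
    _ < ⊤ := ENNReal.mul_lt_top hg.2 (ENNReal.mul_lt_top hf.2 (K.eLpNorm_lt_top _ volume))

theorem integral_mul_op (hp : 1 ≤ p) {f : E n → ℂ} (hf : MemLp f p volume) (χ : 𝓢(E n, ℂ))
    {g : E n → ℂ} (hg : Integrable g) :
    ∫ y, g y * op χ f y = ∫ x, f x * (fconst n * ∫ y, g y * schwartzFourier n χ (x - y)) := by
  have hint := integrable_conv_mul hp hf (schwartzFourier n χ) hg
  calc ∫ y, g y * op χ f y
      = fconst n * ∫ y, ∫ x, g y * (f x * schwartzFourier n χ (x - y)) := by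
        rw [← integral_const_mul]
        refine integral_congr_ae (.of_forall fun y => ?_)
        simp only [op, integral_const_mul]
        ring
    _ = fconst n * ∫ x, ∫ y, g y * (f x * schwartzFourier n χ (x - y)) := by
        rw [integral_integral_swap hint]
    _ = _ := by
        rw [← integral_const_mul]
        refine integral_congr_ae (.of_forall fun x => ?_)
        simp only [mul_left_comm _ (f x), integral_const_mul]

/-- Fubini moves the kernel onto the test function; the convolution operator thus agrees with the
distributional multiplier `𝓕⁻¹ (χ 𝓕 f)`. -/
theorem pair_op (hp : 1 ≤ p) {f : E n → ℂ} (hf : MemLp f p volume) (χ φ : 𝓢(E n, ℂ)) :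
    pair (op χ f) φ = pair f (schwartzFourier n (mulS χ (schwartzFourierInv n φ))) := by
  unfold pair
  rw [integral_mul_op hp hf χ φ.integrable]
  refine integral_congr_ae (.of_forall fun x => ?_)
  simp only [schwartzFourier_mulS, mul_comm (f x)]

/-- Membership of `a - b` for `a` in the support of `ψ` and `b` in the support of `χ` is the only
way in which the spectrum of `f` enters the pairing of `f · op χ g` with `𝓕 ψ`. -/
theorem exists_pair_mul_op (hp : 1 ≤ p) (hr : 1 ≤ r) {f g : E n → ℂ} (hf : MemLp f p volume)
    (hg : MemLp g r volume) (χ ψ : 𝓢(E n, ℂ)) :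
    ∃ θ : E n → 𝓢(E n, ℂ), (∀ s ζ, (∀ η, χ η ≠ 0 → ψ (ζ + η) = 0) → θ s ζ = 0) ∧
      pair (f * op χ g) (schwartzFourier n ψ) =
        ∫ s, g s * (fconst n * pair f (schwartzFourier n (θ s))) := by
  -- After Fubini, `f` is paired for each `s` with `y ↦ 𝓕 χ (s - y) · 𝓕 ψ y`; `θ s` is its inverse
  -- Fourier transform.
  refine ⟨fun s => schwartzFourierInv n
    (mulS (reflectS s (schwartzFourier n χ)) (schwartzFourier n ψ)), fun s ζ h => ?_, ?_⟩
  · rw [schwartzFourierInv_mulS_reflectS]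
    have : ∀ η, χ η * (Complex.exp (-Complex.I * (inner ℝ η s : ℝ)) * ψ (ζ + η)) = 0 := by
      intro η
      by_cases hη : χ η = 0
      · simp [hη]
      · simp [h η hη]
    simp only [this, integral_zero, mul_zero]
  · have h1 := integral_mul_op hr hg χ (integrable_mul_schwartz hp hf (schwartzFourier n ψ))
    have h2 : pair (f * op χ g) (schwartzFourier n ψ) =
        ∫ y, f y * schwartzFourier n ψ y * op χ g y := by
      refine integral_congr_ae (.of_forall fun y => ?_)
      simp only [Pi.mul_apply]
      ring
    rw [h2, h1]
    refine integral_congr_ae (.of_forall fun s => ?_)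
    simp only [schwartzFourier_schwartzFourierInv, pair, mulS_apply, reflectS_apply]
    congr! 4 with y
    ring

/-- An `Lᵖ` class is determined by its distribution, so the infimum ranges over a single element. -/
theorem distLpNorm_toDist [Fact (1 ≤ p)] {f : E n → ℂ} (hf : MemLp f p volume) {T : 𝓢'(E n, ℂ)}
    (hT : ∀ φ, T φ = pair f φ) : distLpNorm p T = eLpNorm f p volume := by
  have hT' : Lp.toTemperedDistribution (hf.toLp f) = T := by
    ext φ
    rw [hT, ← toDist_apply hf, toDist, dif_pos hf]
  unfold distLpNorm
  rw [← Lp.enorm_toLp hf]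
  refine le_antisymm (iInf₂_le (hf.toLp f) hT') (le_iInf₂ fun h hh => ?_)
  have hker := Lp.ker_toTemperedDistributionCLM_eq_bot (F := ℂ) (μ := (volume : Measure (E n)))
    (p := p)
  have : h = hf.toLp f := by
    refine LinearMap.ker_eq_bot.1 hker ?_
    change Lp.toTemperedDistribution h = Lp.toTemperedDistribution (hf.toLp f)
    rw [hh, hT']
  rw [this]

end op

/-! ### The uniform partition of unity -/

section window

variable {n : ℕ} {ρ : E n → ℝ}

theorem IsWindow.abs_le_one (hρ : IsWindow ρ) {ξ : E n} (h : ρ ξ ≠ 0) (i : Fin n) : |ξ i| ≤ 1 :=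
  hρ.supp (subset_tsupport ρ h) i

theorem IsWindow.abs_sub_le_one (hρ : IsWindow ρ) {ξ : E n} {m : Fin n → ℤ}
    (h : ρ (ξ - lat m) ≠ 0) (i : Fin n) : |ξ i - m i| ≤ 1 := by
  simpa [lat] using hρ.abs_le_one h i

theorem IsWindow.exists_finset (hρ : IsWindow ρ) (b : ℝ) :
    ∃ F : Finset (Fin n → ℤ), ∀ m ∉ F, ∀ ξ : E n, ‖ξ‖ ≤ b → ρ (ξ - lat m) = 0 := by
  refine ⟨Finset.Icc (fun _ => -⌈b + 1⌉) (fun _ => ⌈b + 1⌉), fun m hm ξ hξ => ?_⟩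
  by_contra h
  have key : ∀ i, |(m i : ℝ)| ≤ (⌈b + 1⌉ : ℤ) := by
    intro i
    have h1 := hρ.abs_sub_le_one h i
    have h2 : |ξ i| ≤ b := (PiLp.norm_apply_le ξ i).trans hξ
    rw [abs_le] at h1 h2
    have h3 : |(m i : ℝ)| ≤ b + 1 := abs_le.2 ⟨by linarith, by linarith⟩
    exact h3.trans (Int.le_ceil _)
  have key' : ∀ i, |m i| ≤ ⌈b + 1⌉ := fun i => by exact_mod_cast key i
  exact hm (Finset.mem_Icc.2 ⟨fun i => (abs_le.1 (key' i)).1, fun i => (abs_le.1 (key' i)).2⟩)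

/-- The denominator in the definition of `sigma`. -/
def windowSum (ρ : E n → ℝ) (ξ : E n) : ℝ := ∑' m : Fin n → ℤ, ρ (ξ - lat m)

theorem windowSum_eq_sum {F : Finset (Fin n → ℤ)} {ξ : E n}
    (hF : ∀ m ∉ F, ρ (ξ - lat m) = 0) : windowSum ρ ξ = ∑ m ∈ F, ρ (ξ - lat m) :=
  tsum_eq_sum hF

theorem IsWindow.one_le_windowSum (hρ : IsWindow ρ) (ξ : E n) : 1 ≤ windowSum ρ ξ := by
  obtain ⟨F, hF⟩ := hρ.exists_finset ‖ξ‖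
  have hF' : ∀ m ∉ F, ρ (ξ - lat m) = 0 := fun m hm => hF m hm ξ le_rfl
  rw [windowSum_eq_sum hF']
  -- The nearest lattice point is within `1/2` in each coordinate, where the window equals 1.
  set m : Fin n → ℤ := fun i => round (ξ i) with hm
  have h1 : ρ (ξ - lat m) = 1 := hρ.eq_one _ fun i => by
    simpa [lat, hm] using abs_sub_round (ξ i)
  have hmF : m ∈ F := by
    by_contra h
    rw [hF' m h] at h1
    exact zero_ne_one h1
  rw [← h1]
  exact Finset.single_le_sum (f := fun m => ρ (ξ - lat m)) (fun m _ => hρ.nonneg _) hmF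

theorem IsWindow.contDiff_windowSum (hρ : IsWindow ρ) : ContDiff ℝ ∞ (windowSum ρ) := by
  rw [contDiff_iff_contDiffAt]
  intro ξ
  obtain ⟨F, hF⟩ := hρ.exists_finset (‖ξ‖ + 1)
  have hev : windowSum ρ =ᶠ[𝓝 ξ] fun ζ => ∑ m ∈ F, ρ (ζ - lat m) := by
    have : ∀ᶠ ζ in 𝓝 ξ, ‖ζ‖ < ‖ξ‖ + 1 :=
      continuous_norm.continuousAt.eventually_lt_const (lt_add_one _)
    filter_upwards [this] with ζ hζ
    exact windowSum_eq_sum fun m hm => hF m hm ζ hζ.le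
  refine ContDiffAt.congr_of_eventuallyEq ?_ hev
  have := hρ.smooth
  fun_prop

theorem IsWindow.contDiff_sigma (hρ : IsWindow ρ) (k : Fin n → ℤ) :
    ContDiff ℝ ∞ (sigma ρ k) := by
  have h1 : ContDiff ℝ ∞ fun ξ : E n => ρ (ξ - lat k) :=
    hρ.smooth.comp (contDiff_id.sub contDiff_const)
  exact h1.div hρ.contDiff_windowSum fun ξ => (zero_lt_one.trans_le (hρ.one_le_windowSum ξ)).ne'

/-- The closed cube of side `2` centred at a lattice point. -/
def latCube (k : Fin n → ℤ) : Set (E n) := {ξ | ∀ i, |ξ i - k i| ≤ 1}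

theorem isClosed_latCube (k : Fin n → ℤ) : IsClosed (latCube k) := by
  simp only [latCube, Set.ofPred_forall]
  exact isClosed_iInter fun i => isClosed_le (by fun_prop) continuous_const

theorem isCompact_latCube (k : Fin n → ℤ) : IsCompact (latCube k) := by
  have h : latCube k ⊆ Metric.closedBall (lat k) √n := by
    intro ξ hξ
    rw [mem_closedBall_iff_norm, EuclideanSpace.norm_eq]
    gcongr
    calc ∑ i, ‖(ξ - lat k) i‖ ^ 2 ≤ ∑ _i : Fin n, (1 : ℝ) := by
          gcongr with i
          rw [Real.norm_eq_abs, sq_abs]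
          have := hξ i
          rw [abs_le] at this
          simp only [lat, PiLp.sub_apply]
          nlinarith
      _ = n := by simp
  exact (isCompact_closedBall _ _).of_isClosed_subset (isClosed_latCube k) h

theorem IsWindow.tsupport_sigma_subset (hρ : IsWindow ρ) (k : Fin n → ℤ) :
    tsupport (sigma ρ k) ⊆ latCube k := by
  refine closure_minimal (fun ξ hξ => ?_) (isClosed_latCube k)
  refine hρ.abs_sub_le_one fun h => hξ ?_
  simp [sigma, h]

theorem IsWindow.hasCompactSupport_sigma (hρ : IsWindow ρ) (k : Fin n → ℤ) :
    HasCompactSupport fun ξ => (sigma ρ k ξ : ℂ) := by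
  have h : HasCompactSupport (sigma ρ k) := (isCompact_latCube k).of_isClosed_subset
    (isClosed_tsupport _) (hρ.tsupport_sigma_subset k)
  exact h.comp_left (g := Complex.ofReal) rfl

/-- The symbol `σ_k` as a Schwartz function. -/
def sigmaS (hρ : IsWindow ρ) (k : Fin n → ℤ) : 𝓢(E n, ℂ) :=
  (hρ.hasCompactSupport_sigma k).toSchwartzMap
    (Complex.ofRealCLM.contDiff.comp (hρ.contDiff_sigma k))

theorem sigmaS_apply (hρ : IsWindow ρ) (k : Fin n → ℤ) (ξ : E n) :
    sigmaS hρ k ξ = (sigma ρ k ξ : ℂ) := rfl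

theorem tsupport_sigmaS_subset (hρ : IsWindow ρ) (k : Fin n → ℤ) :
    tsupport (sigmaS hρ k) ⊆ latCube k := by
  refine closure_minimal (fun ξ hξ => ?_) (isClosed_latCube k)
  refine hρ.tsupport_sigma_subset k (subset_tsupport _ fun h => hξ ?_)
  rw [sigmaS_apply, h, Complex.ofReal_zero]

theorem hasCompactSupport_sigmaS (hρ : IsWindow ρ) (k : Fin n → ℤ) :
    HasCompactSupport (sigmaS hρ k) :=
  (isCompact_latCube k).of_isClosed_subset (isClosed_tsupport _) (tsupport_sigmaS_subset hρ k)

/-- Translation of Schwartz functions. -/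
abbrev translateS (a : E n) (χ : 𝓢(E n, ℂ)) : 𝓢(E n, ℂ) := SchwartzMap.compSubConstCLM ℂ a χ

/-- The denominator is periodic. This is the source of all bounds uniform in `k`. -/
theorem sigmaS_eq_translateS (hρ : IsWindow ρ) (k : Fin n → ℤ) :
    sigmaS hρ k = translateS (lat k) (sigmaS hρ 0) := by
  ext ξ
  rw [SchwartzMap.compSubConstCLM_apply, sigmaS_apply, sigmaS_apply]
  have h0 : lat (0 : Fin n → ℤ) = 0 := by
    ext i
    simp [lat]
  have h1 : ∑' m, ρ (ξ - lat k - lat m) = ∑' m, ρ (ξ - lat m) := by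
    rw [← (Equiv.addLeft k).tsum_eq (fun m => ρ (ξ - lat m))]
    simp only [Equiv.coe_addLeft, lat_add, sub_sub]
  simp only [sigma, h0, h1, sub_zero]

theorem IsWindow.exists_sum_sigmaS (hρ : IsWindow ρ) {ψ : 𝓢(E n, ℂ)} (hψ : HasCompactSupport ψ) :
    ∃ F : Finset (Fin n → ℤ), (∀ k ∉ F, mulS (sigmaS hρ k) ψ = 0) ∧
      ∑ k ∈ F, mulS (sigmaS hρ k) ψ = ψ := by
  obtain ⟨b, hb⟩ := hψ.isCompact.isBounded.exists_norm_le
  obtain ⟨F, hF⟩ := hρ.exists_finset b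
  refine ⟨F, fun k hk => ?_, ?_⟩
  · ext ξ
    rw [mulS_apply]
    by_cases hξ : ψ ξ = 0
    · simp [hξ]
    · simp [sigmaS_apply, sigma, hF k hk ξ (hb ξ (subset_tsupport _ hξ))]
  · ext ξ
    rw [sum_apply]
    simp only [mulS_apply]
    rw [← Finset.sum_mul]
    by_cases hξ : ψ ξ = 0
    · simp [hξ]
    · have h1 : ∀ m ∉ F, ρ (ξ - lat m) = 0 := fun m hm =>
        hF m hm ξ (hb ξ (subset_tsupport _ hξ))
      have h2 : ∑ k ∈ F, sigma ρ k ξ = 1 := by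
        simp only [sigma]
        rw [← Finset.sum_div, ← windowSum_eq_sum h1]
        exact div_self (zero_lt_one.trans_le (hρ.one_le_windowSum ξ)).ne'
      simp only [sigmaS_apply]
      rw [← Complex.ofReal_sum, h2, Complex.ofReal_one, one_mul]

/-- Translating a symbol modulates its kernel, so all kernel norms are unaffected. -/
theorem norm_schwartzFourier_translateS (a : E n) (χ : 𝓢(E n, ℂ)) (x : E n) :
    ‖schwartzFourier n (translateS a χ) x‖ = ‖schwartzFourier n χ x‖ := by
  have h : schwartzFourier n (translateS a χ) x =
      Complex.exp (-Complex.I * (inner ℝ a x : ℝ)) * schwartzFourier n χ x := by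
    simp only [schwartzFourier_apply, SchwartzMap.compSubConstCLM_apply]
    rw [mul_left_comm]
    congr 1
    rw [← integral_const_mul, ← integral_sub_right_eq_self (fun ξ =>
      Complex.exp (-Complex.I * (inner ℝ a x : ℝ)) *
        (Complex.exp (-Complex.I * (inner ℝ ξ x : ℝ)) * χ ξ)) a]
    congr 1
    ext ξ
    rw [← mul_assoc, ← Complex.exp_add, inner_sub_left]
    push_cast
    ring_nf
  rw [h, norm_mul, norm_exp_neg_I_mul, one_mul]

theorem eLpNorm_schwartzFourier_translateS (a : E n) (χ : 𝓢(E n, ℂ)) (p : ℝ≥0∞) :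
    eLpNorm (schwartzFourier n (translateS a χ)) p volume =
      eLpNorm (schwartzFourier n χ) p volume :=
  eLpNorm_congr_norm_ae (.of_forall (norm_schwartzFourier_translateS a χ))

theorem box_toDist_apply (hρ : IsWindow ρ) {p : ℝ≥0∞} [hp : Fact (1 ≤ p)] {f : E n → ℂ}
    (hf : MemLp f p volume) (k : Fin n → ℤ) (φ : 𝓢(E n, ℂ)) :
    box ρ k (toDist p f) φ = pair (op (sigmaS hρ k) f) φ := by
  rw [pair_op hp.out hf, ← toDist_apply hf]
  rfl

theorem distLpNorm_box (hρ : IsWindow ρ) {p : ℝ≥0∞} [hp : Fact (1 ≤ p)] {f : E n → ℂ}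
    (hf : MemLp f p volume) (k : Fin n → ℤ) :
    distLpNorm p (box ρ k (toDist p f)) = eLpNorm (op (sigmaS hρ k) f) p volume :=
  distLpNorm_toDist (memLp_op hp.out hf _) (box_toDist_apply hρ hf k)

end window

/-! ### Cut-off functions and supports of tempered distributions -/

section support

variable {n : ℕ}

open scoped Manifold in
theorem exists_schwartz_cutoff {K U : Set (E n)} (hK : IsCompact K) (hU : IsOpen U)
    (hKU : K ⊆ U) : ∃ χ : 𝓢(E n, ℂ), HasCompactSupport χ ∧ tsupport χ ⊆ U ∧
      ∀ᶠ x in 𝓝ˢ K, χ x = 1 := by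
  obtain ⟨L, hL, hKL, hLU⟩ := exists_compact_between hK hU hKU
  obtain ⟨f, hf1, hf0, -⟩ := exists_contMDiffMap_one_nhds_of_subset_interior 𝓘(ℝ, E n) (n := ⊤)
    hK.isClosed hKL
  have hsub : tsupport (Complex.ofRealCLM ∘ f) ⊆ L := by
    refine closure_minimal (fun x hx => ?_) hL.isClosed
    by_contra h
    exact hx (by simp [hf0 x h])
  have hc : HasCompactSupport (Complex.ofRealCLM ∘ f) :=
    hL.of_isClosed_subset (isClosed_tsupport _) hsub
  have hd : ContDiff ℝ ∞ (Complex.ofRealCLM ∘ f) :=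
    Complex.ofRealCLM.contDiff.comp f.contMDiff.contDiff
  refine ⟨hc.toSchwartzMap hd, hc, hsub.trans hLU, ?_⟩
  filter_upwards [hf1] with x hx
  simp [hx]

open scoped Manifold in
-- The support is defined by local vanishing; a finite smooth partition of unity on the compact
-- support of `ψ` makes it global.
theorem eq_zero_of_disjoint_dsupport {T : 𝓢'(E n, ℂ)} {ψ : 𝓢(E n, ℂ)} (hψ : HasCompactSupport ψ)
    (h : Disjoint (tsupport ψ) (Distribution.dsupport T)) : T ψ = 0 := by
  have hx : ∀ x : tsupport ψ, ∃ s : Set (E n), Distribution.IsVanishingOn T s ∧ IsOpen s ∧ x.1 ∈ s :=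
    fun x => (Distribution.notMem_dsupport_iff x.1).1 (Set.disjoint_left.1 h x.2)
  choose s hsv hso hxs using hx
  obtain ⟨t, ht⟩ := hψ.isCompact.elim_finite_subcover s hso
    fun x hx => Set.mem_iUnion.2 ⟨⟨x, hx⟩, hxs _⟩
  have ht' : tsupport ψ ⊆ ⋃ i : t, s i := by
    simpa [Set.iUnion_subtype] using ht
  obtain ⟨f, hf⟩ := SmoothPartitionOfUnity.exists_isSubordinate 𝓘(ℝ, E n)
    (isClosed_tsupport ψ) (fun i : t => s i) (fun i => hso i) ht'
  have hc : ∀ i : t, HasCompactSupport fun x => (f i x : ℂ) * ψ x := fun i => hψ.mul_left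
  have hd : ∀ i : t, ContDiff ℝ ∞ fun x => (f i x : ℂ) * ψ x := fun i =>
    (Complex.ofRealCLM.contDiff.comp (f i).contMDiff.contDiff).mul (ψ.smooth ⊤)
  have hsum : ψ = ∑ i : t, (hc i).toSchwartzMap (hd i) := by
    ext x
    rw [sum_apply]
    change ψ x = ∑ i : t, (f i x : ℂ) * ψ x
    rw [← Finset.sum_mul]
    by_cases hx : ψ x = 0
    · simp [hx]
    · have := f.sum_eq_one (subset_tsupport _ hx)
      rw [finsum_eq_sum_of_fintype] at this
      rw [← Complex.ofReal_sum, this, Complex.ofReal_one, one_mul]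
  rw [hsum, map_sum]
  refine Finset.sum_eq_zero fun i _ => hsv i _ ?_
  have h1 : tsupport (fun x => (f i x : ℂ) * ψ x) ⊆ tsupport (f i) := by
    refine closure_mono fun x hx h0 => hx ?_
    dsimp only
    rw [h0, Complex.ofReal_zero, zero_mul]
  exact h1.trans (hf i)

theorem dsupport_subset_of_isClosed {T : 𝓢'(E n, ℂ)} {C : Set (E n)} (hC : IsClosed C)
    (h : ∀ ψ : 𝓢(E n, ℂ), HasCompactSupport ψ → Disjoint (tsupport ψ) C → T ψ = 0) :
    Distribution.dsupport T ⊆ C := by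
  intro x hx
  by_contra hxC
  obtain ⟨r, hr, hrC⟩ := Metric.isOpen_iff.1 hC.isOpen_compl x hxC
  refine (Distribution.mem_dsupport_iff_not_isVanishingOn x).1 hx (Metric.ball x r)
    (Metric.mem_ball_self hr) Metric.isOpen_ball fun ψ hψ => h ψ ?_ ?_
  · exact (isCompact_closedBall x r).of_isClosed_subset (isClosed_tsupport _)
      (hψ.trans Metric.ball_subset_closedBall)
  · exact Set.disjoint_left.2 fun y hy => hrC (hψ hy)

end support

/-! ### Spectra of `Lᵖ` functions -/

section spectrum

variable {n : ℕ} {p r : ℝ≥0∞}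

/-- The support of the Fourier transform of a function in `Lᵖ`. -/
abbrev spec (p : ℝ≥0∞) [Fact (1 ≤ p)] (f : E n → ℂ) : Set (E n) :=
  Distribution.dsupport (distFourier n (toDist p f))

theorem distFourier_toDist_apply [Fact (1 ≤ p)] {f : E n → ℂ} (hf : MemLp f p volume)
    (ψ : 𝓢(E n, ℂ)) : distFourier n (toDist p f) ψ = pair f (schwartzFourier n ψ) :=
  toDist_apply hf _

theorem pair_eq_zero_of_disjoint [Fact (1 ≤ p)] {f : E n → ℂ} (hf : MemLp f p volume)
    {ψ : 𝓢(E n, ℂ)} (hψ : HasCompactSupport ψ) (h : Disjoint (tsupport ψ) (spec p f)) :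
    pair f (schwartzFourier n ψ) = 0 := by
  rw [← distFourier_toDist_apply hf]
  exact eq_zero_of_disjoint_dsupport hψ h

theorem spec_subset [Fact (1 ≤ p)] {f : E n → ℂ} (hf : MemLp f p volume) {C : Set (E n)}
    (hC : IsClosed C) (h : ∀ ψ : 𝓢(E n, ℂ), HasCompactSupport ψ → Disjoint (tsupport ψ) C →
      pair f (schwartzFourier n ψ) = 0) : spec p f ⊆ C :=
  dsupport_subset_of_isClosed hC fun ψ hψ hd => by
    rw [distFourier_toDist_apply hf]
    exact h ψ hψ hd

theorem pair_op_schwartzFourier (hp : 1 ≤ p) {f : E n → ℂ} (hf : MemLp f p volume)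
    (χ ψ : 𝓢(E n, ℂ)) :
    pair (op χ f) (schwartzFourier n ψ) = pair f (schwartzFourier n (mulS χ ψ)) := by
  rw [pair_op hp hf, schwartzFourierInv_schwartzFourier]

theorem pair_zero (f : E n → ℂ) : pair f 0 = 0 := by simp [pair]

theorem tsupport_mulS_subset_left (χ ψ : 𝓢(E n, ℂ)) : tsupport (mulS χ ψ) ⊆ tsupport χ :=
  closure_mono fun x hx h0 => hx (by rw [mulS_apply, h0, zero_mul])

theorem mulS_eq_zero_of_disjoint {χ ψ : 𝓢(E n, ℂ)} (h : Disjoint (tsupport ψ) (tsupport χ)) :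
    mulS χ ψ = 0 := by
  ext x
  rw [mulS_apply]
  by_cases hx : χ x = 0
  · simp [hx]
  · by_cases hx' : ψ x = 0
    · simp [hx']
    · exact absurd (subset_tsupport _ hx) (Set.disjoint_left.1 h (subset_tsupport _ hx'))

theorem hasCompactSupport_mulS {χ : 𝓢(E n, ℂ)} (hχ : HasCompactSupport χ) (ψ : 𝓢(E n, ℂ)) :
    HasCompactSupport (mulS χ ψ) :=
  hχ.isCompact.of_isClosed_subset (isClosed_tsupport _) (tsupport_mulS_subset_left χ ψ)

theorem spec_op_subset_tsupport [hp : Fact (1 ≤ p)] {f : E n → ℂ} (hf : MemLp f p volume)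
    (χ : 𝓢(E n, ℂ)) : spec p (op χ f) ⊆ tsupport χ := by
  refine spec_subset (memLp_op hp.out hf χ) (isClosed_tsupport _) fun ψ hψ hd => ?_
  rw [pair_op_schwartzFourier hp.out hf, mulS_eq_zero_of_disjoint hd, map_zero, pair_zero]

/-- A multiplier that equals `1` near the part of the spectrum of `g` seen by `σ` acts trivially
on `op σ g`. -/
theorem op_op_eq_self [hp : Fact (1 ≤ p)] {g : E n → ℂ} (hg : MemLp g p volume)
    {σ χ : 𝓢(E n, ℂ)} (hσ : HasCompactSupport σ)
    (hχ : ∀ᶠ x in 𝓝ˢ (tsupport σ ∩ spec p g), χ x = 1) : op χ (op σ g) =ᵐ[volume] op σ g := by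
  have hσg := memLp_op hp.out hg σ
  refine ae_eq_of_pair_eq hp.out hp.out (memLp_op hp.out hσg χ) hσg fun φ _ => ?_
  set ψ := schwartzFourierInv n φ with hψ
  have hφ : φ = schwartzFourier n ψ := (schwartzFourier_schwartzFourierInv φ).symm
  rw [hφ, pair_op_schwartzFourier hp.out hσg, pair_op_schwartzFourier hp.out hg,
    pair_op_schwartzFourier hp.out hg, ← sub_eq_zero, ← distFourier_toDist_apply hg,
    ← distFourier_toDist_apply hg, ← map_sub]
  -- `δ = σ (χ - 1) ψ` must vanish near the spectrum of `g`, not just on it, for its support to be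
  -- disjoint from the spectrum.
  set δ := mulS σ (mulS χ ψ) - mulS σ ψ with hδ
  have hδ_apply : ∀ x, δ x = σ x * (χ x - 1) * ψ x := by
    intro x
    rw [hδ, sub_apply, mulS_apply, mulS_apply, mulS_apply]
    ring
  have hδσ : tsupport δ ⊆ tsupport σ :=
    closure_mono fun x hx h0 => hx (by rw [hδ_apply, h0, zero_mul, zero_mul])
  refine eq_zero_of_disjoint_dsupport
    (hσ.isCompact.of_isClosed_subset (isClosed_tsupport _) hδσ) ?_
  refine Set.disjoint_left.2 fun x hx hx' => ?_
  have hx1 : ∀ᶠ y in 𝓝 x, χ y = 1 := eventually_nhdsSet_iff_forall.1 hχ x ⟨hδσ hx, hx'⟩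
  refine notMem_tsupport_iff_eventuallyEq.2 ?_ hx
  filter_upwards [hx1] with y hy
  rw [hδ_apply, hy]
  simp

/-- Spectra add under multiplication: every `θ s` of `exists_pair_mul_op` is supported in the
compact set `supp ψ - supp χ`, which misses the spectrum of `f`. -/
theorem pair_mul_op_eq_zero [hp : Fact (1 ≤ p)] (hr : 1 ≤ r) {f g : E n → ℂ}
    (hf : MemLp f p volume) (hg : MemLp g r volume) {χ ψ : 𝓢(E n, ℂ)}
    (hχ : HasCompactSupport χ) (hψ : HasCompactSupport ψ)
    (h : ∀ ζ ∈ spec p f, ∀ η ∈ tsupport χ, ζ + η ∉ tsupport ψ) :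
    pair (f * op χ g) (schwartzFourier n ψ) = 0 := by
  obtain ⟨θ, hθ, e⟩ := exists_pair_mul_op hp.out hr hf hg χ ψ
  have hcomp : IsCompact ((fun z : E n × E n => z.1 - z.2) '' (tsupport ψ ×ˢ tsupport χ)) :=
    (hψ.isCompact.prod hχ.isCompact).image (by fun_prop)
  have hsub : ∀ s, tsupport (θ s) ⊆
      (fun z : E n × E n => z.1 - z.2) '' (tsupport ψ ×ˢ tsupport χ) := by
    intro s
    refine closure_minimal (fun ζ hζ => ?_) hcomp.isClosed
    by_contra hcon
    refine hζ (hθ s ζ fun η hη => ?_)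
    by_contra hη'
    exact hcon ⟨(ζ + η, η), ⟨subset_tsupport _ hη', subset_tsupport _ hη⟩, by simp⟩
  rw [e]
  have : ∀ s, pair f (schwartzFourier n (θ s)) = 0 := by
    intro s
    refine pair_eq_zero_of_disjoint hf
      (hcomp.of_isClosed_subset (isClosed_tsupport _) (hsub s)) ?_
    refine Set.disjoint_left.2 fun ζ hζ hζ' => ?_
    obtain ⟨⟨a, b⟩, ⟨ha, hb⟩, hab⟩ := hsub s hζ
    refine h ζ hζ' b hb ?_
    rw [← hab]
    simpa using ha
  simp [this]

/-! ### Summing the frequency-localized pieces -/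

/-- The series converges absolutely in `L^r`. Its sum is `f`, since against `𝓕 ψ` with `ψ` compactly
supported only finitely many pieces count and the symbols add up to 1; such test functions are
dense. The second exponent `r` serves both `r = p` and `r = ⊤`. -/
theorem memLp_of_decomposition {ρ : E n → ℝ} (hρ : IsWindow ρ) [hp : Fact (1 ≤ p)]
    [hr : Fact (1 ≤ r)] {f : E n → ℂ} (hf : MemLp f p volume)
    (hur : ∀ k, MemLp (op (sigmaS hρ k) f) r volume)
    (hsum : ∑' k, eLpNorm (op (sigmaS hρ k) f) r volume < ⊤) :
    MemLp f r volume ∧ Tendsto (fun F : Finset (Fin n → ℤ) =>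
      eLpNorm (f - ∑ k ∈ F, op (sigmaS hρ k) f) r volume) atTop (𝓝 0) := by
  set U : (Fin n → ℤ) → Lp ℂ r (volume : Measure (E n)) := fun k => (hur k).toLp _ with hU
  have hnorm : Summable fun k => ‖U k‖ := by
    have h1 : ∀ k, ‖U k‖ = (eLpNorm (op (sigmaS hρ k) f) r volume).toReal :=
      fun k => Lp.norm_toLp _ _
    simp_rw [h1]
    exact ENNReal.summable_toReal hsum.ne
  obtain ⟨h, hh⟩ := hnorm.of_norm
  have hpairU : ∀ k φ, pair (U k) φ = pair (op (sigmaS hρ k) f) φ := fun k φ =>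
    pair_congr_ae (hur k).coeFn_toLp φ
  have hpair : ∀ φ, HasSum (fun k => pair (op (sigmaS hρ k) f) φ) (pair h φ) := by
    intro φ
    have hcont : Continuous fun u : Lp ℂ r (volume : Measure (E n)) =>
        Lp.toTemperedDistributionCLM ℂ volume r u φ :=
      (continuous_eval_const φ).comp
        (Lp.toTemperedDistributionCLM ℂ volume r).continuous
    have h2 := (hcont.tendsto h).comp hh
    have h3 : ∀ u : Lp ℂ r (volume : Measure (E n)),
        Lp.toTemperedDistributionCLM ℂ volume r u φ = pair u φ := fun u => by
      simp [pair]
    rw [h3] at h2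
    refine h2.congr fun F => ?_
    simp only [Function.comp_apply, map_sum]
    rw [sum_apply]
    refine Finset.sum_congr rfl fun k _ => ?_
    rw [h3, hpairU]
  have hfh : f =ᵐ[volume] h := by
    refine ae_eq_of_pair_eq hp.out hr.out hf (Lp.memLp h) fun φ _ => ?_
    have hS : (fun ψ => pair f (schwartzFourier n ψ)) =
        fun ψ => pair (h : E n → ℂ) (schwartzFourier n ψ) := by
      refine eq_of_eq_on_hasCompactSupport
        ((continuous_pair hp.out hf).comp (schwartzFourier n).continuous)
        ((continuous_pair hr.out (Lp.memLp h)).comp (schwartzFourier n).continuous) fun ψ hψ => ?_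
      obtain ⟨F, hF0, hF1⟩ := hρ.exists_sum_sigmaS hψ
      have h4 : HasSum (fun k => pair (op (sigmaS hρ k) f) (schwartzFourier n ψ))
          (∑ k ∈ F, pair (op (sigmaS hρ k) f) (schwartzFourier n ψ)) :=
        hasSum_sum_of_ne_finset_zero fun k hk => by
          rw [pair_op_schwartzFourier hp.out hf, hF0 k hk, map_zero, pair_zero]
      rw [(hpair _).unique h4]
      simp_rw [pair_op_schwartzFourier hp.out hf, ← distFourier_toDist_apply hf]
      rw [← map_sum, hF1]
    have := congrFun hS (schwartzFourierInv n φ)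
    simpa only [schwartzFourier_schwartzFourierInv] using this
  have hfr : MemLp f r volume := (memLp_congr_ae hfh).2 (Lp.memLp h)
  refine ⟨hfr, ?_⟩
  have hlim : Tendsto (fun F : Finset (Fin n → ℤ) => ‖h - ∑ k ∈ F, U k‖ₑ) atTop (𝓝 0) := by
    have h5 : Tendsto (fun F : Finset (Fin n → ℤ) => h - ∑ k ∈ F, U k) atTop (𝓝 0) := by
      simpa using (tendsto_const_nhds (x := h)).sub hh
    have h6 := (continuous_enorm.tendsto _).comp h5
    rw [enorm_zero] at h6
    exact h6
  refine hlim.congr fun F => ?_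
  have hms : MemLp (∑ k ∈ F, op (sigmaS hρ k) f) r volume := memLp_finsetSum' F fun k _ => hur k
  have e : h - ∑ k ∈ F, U k = (hfr.sub hms).toLp _ := by
    rw [MemLp.toLp_sub hfr hms]
    congr 1
    · exact Lp.ext (hfh.symm.trans hfr.coeFn_toLp.symm)
    · refine Lp.ext ?_
      refine EventuallyEq.trans ?_ hms.coeFn_toLp.symm
      refine (Lp.coeFn_finsetSum F U).trans ?_
      refine eventuallyEq_sum fun k _ => (hur k).coeFn_toLp
  rw [e, Lp.enorm_toLp]

end spectrum

/-! ### Products of functions with summable frequency decomposition -/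

section product

variable {n : ℕ} {p : ℝ≥0∞} {ρ : E n → ℝ}

theorem eLpNorm_mul_top_le {f g : E n → ℂ} (hf : AEStronglyMeasurable f volume)
    (hg : AEStronglyMeasurable g volume) :
    eLpNorm (f * g) p volume ≤ eLpNorm f p volume * eLpNorm g ⊤ volume := by
  have h := eLpNorm_smul_le_mul_eLpNorm (p := p) (q := ⊤) (r := p) hg hf
  exact h

theorem memLp_mul_top {f g : E n → ℂ} (hf : MemLp f p volume) (hg : MemLp g ⊤ volume) :
    MemLp (f * g) p volume :=
  MemLp.mul (p := p) (q := ⊤) (r := p) hg hf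

theorem op_finsetSum (hp : 1 ≤ p) {ι : Type*} (F : Finset ι) {u : ι → E n → ℂ}
    (hu : ∀ i, MemLp (u i) p volume) (χ : 𝓢(E n, ℂ)) :
    op χ (∑ i ∈ F, u i) = ∑ i ∈ F, op χ (u i) := by
  classical
  induction F using Finset.induction_on with
  | empty =>
    ext y
    simp [op]
  | insert i F hi ih =>
    rw [Finset.sum_insert hi, Finset.sum_insert hi, ← ih,
      op_add hp (hu i) (memLp_finsetSum' F fun i _ => hu i)]

theorem enorm_pair_le (hp : 1 ≤ p) {f : E n → ℂ} (hf : AEStronglyMeasurable f volume)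
    (φ : 𝓢(E n, ℂ)) : ‖pair f φ‖ₑ ≤ eLpNorm f p volume * eLpNorm φ (1 - p⁻¹)⁻¹ volume := by
  have h := eLpNorm_one_mul_shift_le hp hf φ 0
  simp only [sub_zero, eLpNorm_one_eq_lintegral_enorm] at h
  refine (enorm_integral_le_lintegral_enorm _).trans (le_trans (le_of_eq ?_) h)
  simp only [mul_comm]

theorem eLpNorm_op_sigmaS_le (hρ : IsWindow ρ) (p : ℝ≥0∞) (hp : 1 ≤ p) :
    ∃ D : ℝ≥0∞, D < ⊤ ∧ ∀ (f : E n → ℂ), AEStronglyMeasurable f volume → ∀ k,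
      eLpNorm (op (sigmaS hρ k) f) p volume ≤ D * eLpNorm f p volume := by
  refine ⟨‖fconst n‖ₑ * eLpNorm (schwartzFourier n (sigmaS hρ 0)) 1 volume,
    ENNReal.mul_lt_top enorm_lt_top (SchwartzMap.eLpNorm_lt_top _ _ _), fun f hf k => ?_⟩
  rw [← eLpNorm_schwartzFourier_translateS (lat k), ← sigmaS_eq_translateS hρ k]
  exact eLpNorm_op_le hp hf _

/-- Bernstein's inequality for the pieces of the uniform decomposition. -/
theorem eLpNorm_top_op_sigmaS_le (hρ : IsWindow ρ) (p : ℝ≥0∞) [hp : Fact (1 ≤ p)] :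
    ∃ B : ℝ≥0∞, B < ⊤ ∧ ∀ (f : E n → ℂ), MemLp f p volume → ∀ k,
      eLpNorm (op (sigmaS hρ k) f) ⊤ volume ≤ B * eLpNorm (op (sigmaS hρ k) f) p volume := by
  obtain ⟨χ, -, -, hχ⟩ := exists_schwartz_cutoff (isCompact_latCube (0 : Fin n → ℤ)) isOpen_univ
    (Set.subset_univ _)
  refine ⟨‖fconst n‖ₑ * eLpNorm (schwartzFourier n χ) (1 - p⁻¹)⁻¹ volume,
    ENNReal.mul_lt_top enorm_lt_top (SchwartzMap.eLpNorm_lt_top _ _ _), fun f hf k => ?_⟩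
  -- The translated cutoff is 1 near the cube of `σ_k`, so it reproduces the piece; its kernel then
  -- maps `L^p` to `L^∞`.
  have h1 : op (translateS (lat k) χ) (op (sigmaS hρ k) f) =ᵐ[volume] op (sigmaS hρ k) f := by
    refine op_op_eq_self hf (hasCompactSupport_sigmaS hρ k) (eventually_nhdsSet_iff_forall.2 ?_)
    rintro x ⟨hx, -⟩
    have hx' : x - lat k ∈ latCube (0 : Fin n → ℤ) := fun i => by
      simpa [lat] using tsupport_sigmaS_subset hρ k hx i
    have h2 : ∀ᶠ y in 𝓝 (x - lat k), χ y = 1 := eventually_nhdsSet_iff_forall.1 hχ _ hx'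
    have h3 : Tendsto (fun y : E n => y - lat k) (𝓝 x) (𝓝 (x - lat k)) :=
      (continuous_id.sub continuous_const).tendsto x
    filter_upwards [h3.eventually h2] with y hy
    rw [SchwartzMap.compSubConstCLM_apply, hy]
  rw [← eLpNorm_schwartzFourier_translateS (lat k), ← eLpNorm_congr_ae h1]
  have h4 := eLpNorm_op_top_le hp.out (memLp_op hp.out hf (sigmaS hρ k)).1 (translateS (lat k) χ)
  exact h4

theorem op_sigmaS_mul_eq_zero (hρ : IsWindow ρ) [hp : Fact (1 ≤ p)] {f g : E n → ℂ}
    (hf : MemLp f p volume) (hg : MemLp g p volume) {k l m : Fin n → ℤ} (h : ¬ Near k l m) :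
    op (sigmaS hρ k) (op (sigmaS hρ l) f * op (sigmaS hρ m) g) =ᵐ[volume] 0 := by
  have hu := memLp_op hp.out hf (sigmaS hρ l)
  have huv := memLp_mul_top hu (memLp_op_top hp.out hg (sigmaS hρ m))
  refine ae_eq_of_pair_eq hp.out hp.out (memLp_op hp.out huv _) MemLp.zero fun φ _ => ?_
  rw [pair_op hp.out huv, pair_mul_op_eq_zero hp.out hu hg (hasCompactSupport_sigmaS hρ m)
    (hasCompactSupport_mulS (hasCompactSupport_sigmaS hρ k) _)]
  · simp [pair]
  · intro ζ hζ η hη hcon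
    refine h fun i => ?_
    have h1 := tsupport_sigmaS_subset hρ l (spec_op_subset_tsupport hf _ hζ) i
    have h2 := tsupport_sigmaS_subset hρ m hη i
    have h3 := tsupport_sigmaS_subset hρ k (tsupport_mulS_subset_left _ _ hcon) i
    rw [abs_le] at h1 h2 h3
    simp only [PiLp.add_apply] at h3
    -- Three cubes of half-width 1 give the 3 in `Near`.
    have h4 : |((k i - l i - m i : ℤ) : ℝ)| ≤ 3 := by
      push_cast
      rw [abs_le]
      constructor <;> linarith [h1.1, h1.2, h2.1, h2.2, h3.1, h3.2]
    exact_mod_cast h4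

/-- The functions in `Lᵖ` whose uniform decomposition converges absolutely. -/
structure Decomposable (hρ : IsWindow ρ) (p : ℝ≥0∞) (f : E n → ℂ) : Prop where
  memLp : MemLp f p volume
  tsum_lt_top : ∑' k, eLpNorm (op (sigmaS hρ k) f) p volume < ⊤

theorem Decomposable.tendsto {hρ : IsWindow ρ} [hp : Fact (1 ≤ p)] {f : E n → ℂ}
    (hf : Decomposable hρ p f) : Tendsto (fun F : Finset (Fin n → ℤ) =>
      eLpNorm (f - ∑ k ∈ F, op (sigmaS hρ k) f) p volume) atTop (𝓝 0) :=
  (memLp_of_decomposition hρ hf.memLp (fun _ => memLp_op hp.out hf.memLp _) hf.tsum_lt_top).2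

/-- Bernstein's inequality makes the series absolutely convergent in `L^∞` as well; in particular
products stay in `L^p`. -/
theorem Decomposable.top {hρ : IsWindow ρ} [hp : Fact (1 ≤ p)] {f : E n → ℂ}
    (hf : Decomposable hρ p f) : MemLp f ⊤ volume ∧ Tendsto (fun F : Finset (Fin n → ℤ) =>
      eLpNorm (f - ∑ k ∈ F, op (sigmaS hρ k) f) ⊤ volume) atTop (𝓝 0) := by
  obtain ⟨B, hB, h⟩ := eLpNorm_top_op_sigmaS_le hρ p
  have : Fact ((1 : ℝ≥0∞) ≤ ⊤) := ⟨le_top⟩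
  refine memLp_of_decomposition hρ hf.memLp (fun k => memLp_op_top hp.out hf.memLp _) ?_
  refine (ENNReal.tsum_le_tsum fun k => h f hf.memLp k).trans_lt ?_
  rw [ENNReal.tsum_mul_left]
  exact ENNReal.mul_lt_top hB hf.tsum_lt_top

theorem Decomposable.memLp_mul {hρ : IsWindow ρ} [hp : Fact (1 ≤ p)] {f g : E n → ℂ}
    (hf : Decomposable hρ p f) (hg : Decomposable hρ p g) : MemLp (f * g) p volume :=
  memLp_mul_top hf.memLp hg.top.1

theorem Decomposable.tendsto_mul {hρ : IsWindow ρ} [hp : Fact (1 ≤ p)] {f g : E n → ℂ}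
    (hf : Decomposable hρ p f) (hg : Decomposable hρ p g) :
    Tendsto (fun F : Finset (Fin n → ℤ) => eLpNorm (f * g -
      (∑ l ∈ F, op (sigmaS hρ l) f) * (∑ m ∈ F, op (sigmaS hρ m) g)) p volume) atTop (𝓝 0) := by
  set fF := fun F : Finset (Fin n → ℤ) => ∑ l ∈ F, op (sigmaS hρ l) f with hfF
  set gF := fun F : Finset (Fin n → ℤ) => ∑ l ∈ F, op (sigmaS hρ l) g with hgF
  have hfm : ∀ F, MemLp (fF F) p volume := fun F =>
    memLp_finsetSum' F fun _ _ => memLp_op hp.out hf.memLp _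
  have hgm : ∀ F, MemLp (gF F) p volume := fun F =>
    memLp_finsetSum' F fun _ _ => memLp_op hp.out hg.memLp _
  have hS : ∀ F, eLpNorm (fF F) p volume ≤ ∑' k, eLpNorm (op (sigmaS hρ k) f) p volume :=
    fun F => (eLpNorm_sum_le (fun _ _ => (memLp_op hp.out hf.memLp _).1) hp.out).trans
      (ENNReal.sum_le_tsum F)
  have hbd : ∀ F, eLpNorm (f * g - fF F * gF F) p volume ≤
      eLpNorm (f - fF F) p volume * eLpNorm g ⊤ volume +
        (∑' k, eLpNorm (op (sigmaS hρ k) f) p volume) * eLpNorm (g - gF F) ⊤ volume := by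
    intro F
    have e : f * g - fF F * gF F = (f - fF F) * g + fF F * (g - gF F) := by ring
    have m1 := hf.memLp.1.sub (hfm F).1
    have m2 := hg.memLp.1.sub (hgm F).1
    rw [e]
    refine (eLpNorm_add_le (m1.mul hg.memLp.1) ((hfm F).1.mul m2) hp.out).trans ?_
    refine add_le_add (eLpNorm_mul_top_le m1 hg.memLp.1) ?_
    refine (eLpNorm_mul_top_le (hfm F).1 m2).trans ?_
    gcongr
    exact hS F
  refine tendsto_of_tendsto_of_tendsto_of_le_of_le tendsto_const_nhds ?_ (fun F => zero_le)
    hbd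
  have t1 := ENNReal.Tendsto.mul_const hf.tendsto (Or.inr hg.top.1.2.ne)
  have t2 := ENNReal.Tendsto.const_mul hg.top.2 (Or.inr hf.tsum_lt_top.ne)
  simpa using t1.add t2

theorem eLpNorm_op_mul_le (hρ : IsWindow ρ) (p : ℝ≥0∞) [hp : Fact (1 ≤ p)] :
    ∃ D : ℝ≥0∞, D < ⊤ ∧ ∀ f g : E n → ℂ, Decomposable hρ p f → Decomposable hρ p g → ∀ k,
      eLpNorm (op (sigmaS hρ k) (f * g)) p volume ≤ D * ∑' l, ∑' m, if Near k l m then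
        eLpNorm (op (sigmaS hρ l) f) p volume * eLpNorm (op (sigmaS hρ m) g) p volume else 0 := by
  obtain ⟨D, hD, hDle⟩ := eLpNorm_op_sigmaS_le hρ p hp.out
  obtain ⟨B, hB, hBle⟩ := eLpNorm_top_op_sigmaS_le hρ p
  refine ⟨D * B, ENNReal.mul_lt_top hD hB, fun f g hf hg k => ?_⟩
  set u := fun l => op (sigmaS hρ l) f with hu
  set v := fun l => op (sigmaS hρ l) g with hv
  have hum : ∀ l, MemLp (u l) p volume := fun l => memLp_op hp.out hf.memLp _
  have hvt : ∀ l, MemLp (v l) ⊤ volume := fun l => memLp_op_top hp.out hg.memLp _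
  have huv : ∀ l m, MemLp (u l * v m) p volume := fun l m => memLp_mul_top (hum l) (hvt m)
  have hterm : ∀ l m, eLpNorm (op (sigmaS hρ k) (u l * v m)) p volume ≤
      D * B * if Near k l m then eLpNorm (u l) p volume * eLpNorm (v m) p volume else 0 := by
    intro l m
    split_ifs with hk
    · calc _ ≤ D * eLpNorm (u l * v m) p volume := hDle _ (huv l m).1 k
        _ ≤ D * (eLpNorm (u l) p volume * eLpNorm (v m) ⊤ volume) := by
            gcongr
            exact eLpNorm_mul_top_le (hum l).1 (hvt m).1
        _ ≤ D * (eLpNorm (u l) p volume * (B * eLpNorm (v m) p volume)) := by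
            gcongr
            exact hBle g hg.memLp m
        _ = _ := by ring
    · rw [eLpNorm_congr_ae (op_sigmaS_mul_eq_zero hρ hf.memLp hg.memLp hk)]
      simp
  set total := D * B * ∑' l, ∑' m, if Near k l m then
    eLpNorm (u l) p volume * eLpNorm (v m) p volume else 0 with htotal
  have hfin : ∀ F : Finset (Fin n → ℤ),
      eLpNorm (op (sigmaS hρ k) ((∑ l ∈ F, u l) * ∑ m ∈ F, v m)) p volume ≤ total := by
    intro F
    rw [Finset.sum_mul_sum, op_finsetSum hp.out F
      (fun l => memLp_finsetSum' F fun m _ => huv l m)]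
    calc _ ≤ ∑ l ∈ F, ∑ m ∈ F, eLpNorm (op (sigmaS hρ k) (u l * v m)) p volume := by
          refine (eLpNorm_sum_le (fun l _ => (memLp_op hp.out
            (memLp_finsetSum' F fun m _ => huv l m) _).1) hp.out).trans ?_
          refine Finset.sum_le_sum fun l _ => ?_
          rw [op_finsetSum hp.out F (fun m => huv l m)]
          exact eLpNorm_sum_le (fun m _ => (memLp_op hp.out (huv l m) _).1) hp.out
      _ ≤ ∑ l ∈ F, ∑ m ∈ F, D * B *
            if Near k l m then eLpNorm (u l) p volume * eLpNorm (v m) p volume else 0 := by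
          gcongr with l _ m _
          exact hterm l m
      _ ≤ ∑' l, ∑' m, D * B *
            if Near k l m then eLpNorm (u l) p volume * eLpNorm (v m) p volume else 0 :=
          (Finset.sum_le_sum fun l _ => ENNReal.sum_le_tsum F).trans (ENNReal.sum_le_tsum F)
      _ = total := by
          simp_rw [ENNReal.tsum_mul_left]
          rfl
  -- The bound holds for products of partial sums; the error made by truncation tends to 0 in `L^p`
  -- and the multiplier is bounded there.
  have hlim : Tendsto (fun F : Finset (Fin n → ℤ) =>
      D * eLpNorm (f * g - (∑ l ∈ F, u l) * (∑ m ∈ F, v m)) p volume + total) atTop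
        (𝓝 total) := by
    have t1 := ENNReal.Tendsto.const_mul (hf.tendsto_mul hg) (Or.inr hD.ne)
    simpa using t1.add_const total
  refine ge_of_tendsto' hlim fun F => ?_
  have m1 : MemLp ((∑ l ∈ F, u l) * ∑ m ∈ F, v m) p volume := by
    rw [Finset.sum_mul_sum]
    exact memLp_finsetSum' F fun l _ => memLp_finsetSum' F fun m _ => huv l m
  have m2 : MemLp (f * g - (∑ l ∈ F, u l) * ∑ m ∈ F, v m) p volume :=
    (hf.memLp_mul hg).sub m1
  have e : op (sigmaS hρ k) (f * g) = op (sigmaS hρ k) (f * g - (∑ l ∈ F, u l) * ∑ m ∈ F, v m) +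
      op (sigmaS hρ k) ((∑ l ∈ F, u l) * ∑ m ∈ F, v m) := by
    rw [← op_add hp.out m2 m1, sub_add_cancel]
  rw [e]
  refine (eLpNorm_add_le (memLp_op hp.out m2 _).1 (memLp_op hp.out m1 _).1 hp.out).trans ?_
  exact add_le_add (hDle _ m2.1 k) (hfin F)

open scoped Pointwise in
-- The cube of `σ_m` is too coarse to see `C`. A finer cutoff, equal to 1 near `supp σ_m ∩ spec g`
-- and supported off the closed set `supp ψ - spec f`, leaves the piece unchanged and makes
-- `pair_mul_op_eq_zero` applicable.
theorem pair_mul_op_sigmaS_eq_zero (hρ : IsWindow ρ) [hp : Fact (1 ≤ p)] {f g : E n → ℂ}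
    (hf : MemLp f p volume) (hg : MemLp g p volume) {C : Set (E n)}
    (hC : ∀ ζ ∈ spec p f, ∀ η ∈ spec p g, ζ + η ∈ C) {ψ : 𝓢(E n, ℂ)}
    (hψ : HasCompactSupport ψ) (hψC : Disjoint (tsupport ψ) C) (m : Fin n → ℤ) :
    pair (f * op (sigmaS hρ m) g) (schwartzFourier n ψ) = 0 := by
  have hV : IsClosed (tsupport ψ + -spec p f) :=
    (Distribution.isClosed_dsupport.neg).add_left_of_isCompact hψ.isCompact
  have hK : IsCompact (tsupport (sigmaS hρ m) ∩ spec p g) :=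
    (hasCompactSupport_sigmaS hρ m).isCompact.inter_right Distribution.isClosed_dsupport
  obtain ⟨χ, hχc, hχU, hχ1⟩ := exists_schwartz_cutoff hK hV.isOpen_compl (by
    rintro η ⟨-, hη⟩ ⟨a, ha, b, hb, hab⟩
    refine Set.disjoint_left.1 hψC ha ?_
    have := hC (-b) hb η hη
    rw [← hab] at this
    simpa using this)
  have e := op_op_eq_self hg (hasCompactSupport_sigmaS hρ m) hχ1
  have e' : f * op (sigmaS hρ m) g =ᵐ[volume] f * op χ (op (sigmaS hρ m) g) := by
    filter_upwards [e] with x hx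
    simp only [Pi.mul_apply, hx]
  rw [pair_congr_ae e']
  refine pair_mul_op_eq_zero hp.out hf (memLp_op hp.out hg _) hχc hψ fun ζ hζ η hη hcon => ?_
  exact hχU hη ⟨ζ + η, hcon, -ζ, by simpa using hζ, by simp⟩

/-- Only `g` is truncated: its partial sums converge in `L^∞`, and every truncated product pairs to
0 with `𝓕 ψ`. -/
theorem Decomposable.spec_mul_subset {hρ : IsWindow ρ} [hp : Fact (1 ≤ p)] {f g : E n → ℂ}
    (hf : Decomposable hρ p f) (hg : Decomposable hρ p g) {C : Set (E n)} (hCc : IsClosed C)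
    (hC : ∀ ζ ∈ spec p f, ∀ η ∈ spec p g, ζ + η ∈ C) : spec p (f * g) ⊆ C := by
  refine spec_subset (hf.memLp_mul hg) hCc fun ψ hψ hd => ?_
  set φ := schwartzFourier n ψ with hφ
  have hv : ∀ F : Finset (Fin n → ℤ), MemLp (∑ m ∈ F, op (sigmaS hρ m) g) ⊤ volume := fun F =>
    memLp_finsetSum' F fun m _ => memLp_op_top hp.out hg.memLp _
  have hzero : ∀ F : Finset (Fin n → ℤ), pair (f * ∑ m ∈ F, op (sigmaS hρ m) g) φ = 0 := by
    intro F
    have h1 : ∀ x, φ x * (f * ∑ m ∈ F, op (sigmaS hρ m) g) x =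
        ∑ m ∈ F, φ x * (f * op (sigmaS hρ m) g) x := by
      intro x
      simp only [Pi.mul_apply, Finset.sum_apply, Finset.mul_sum]
    have h2 : ∀ m, Integrable fun x => φ x * (f * op (sigmaS hρ m) g) x := fun m => by
      simpa only [mul_comm] using integrable_mul_schwartz hp.out
        (memLp_mul_top hf.memLp (memLp_op_top hp.out hg.memLp (sigmaS hρ m))) φ
    unfold pair
    simp_rw [h1]
    rw [integral_finsetSum F fun m _ => h2 m]
    exact Finset.sum_eq_zero fun m _ =>
      pair_mul_op_sigmaS_eq_zero hρ hf.memLp hg.memLp hC hψ hd m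
  have hbd : ∀ F : Finset (Fin n → ℤ), ‖pair (f * g) φ‖ₑ ≤
      eLpNorm f p volume * eLpNorm (g - ∑ m ∈ F, op (sigmaS hρ m) g) ⊤ volume *
        eLpNorm φ (1 - p⁻¹)⁻¹ volume := by
    intro F
    have m1 := memLp_mul_top hf.memLp (hg.top.1.sub (hv F))
    have e : f * g = f * (g - ∑ m ∈ F, op (sigmaS hρ m) g) +
        f * ∑ m ∈ F, op (sigmaS hρ m) g := by ring
    rw [e, pair_add hp.out m1 (memLp_mul_top hf.memLp (hv F)), hzero, add_zero]
    refine (enorm_pair_le hp.out m1.1 φ).trans ?_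
    gcongr
    exact eLpNorm_mul_top_le hf.memLp.1 (hg.top.1.sub (hv F)).1
  have t1 := ENNReal.Tendsto.mul_const (ENNReal.Tendsto.const_mul hg.top.2 (Or.inr hf.memLp.2.ne))
    (b := eLpNorm φ (1 - p⁻¹)⁻¹ volume) (Or.inr (φ.eLpNorm_lt_top _ _).ne)
  rw [mul_zero, zero_mul] at t1
  have h0 := ge_of_tendsto' t1 hbd
  simpa using h0

end product

/-! ### The modulation spaces are algebras -/

section modSpace

variable {n : ℕ} {p q : ℝ≥0∞} {ρ : E n → ℝ} {w : ℝ → ℝ}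

theorem modNorm_eq (hρ : IsWindow ρ) (w : ℝ → ℝ) (q : ℝ≥0∞) [Fact (1 ≤ p)] {f : E n → ℂ}
    (hf : MemLp f p volume) : modNorm ρ w p q f =
      ellNorm q fun k => expWeight w k * eLpNorm (op (sigmaS hρ k) f) p volume := by
  rw [modNorm, if_pos hf]
  simp only [distLpNorm_box hρ hf]
  rfl

/-- The weight outgrows `(1 + |k|)^(2n)`, so the weighted `ℓ^q` condition implies plain summability.
-/
theorem decomposable_of_mem_modSpace (hρ : IsWindow ρ) (hw : w ∈ weightsZero) (hq : 1 ≤ q)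
    [Fact (1 ≤ p)] {f : E n → ℂ} (hf : f ∈ modSpace ρ w p q) : Decomposable hρ p f := by
  refine ⟨hf.1, ?_⟩
  obtain ⟨C, hC, h⟩ := weight_growth hw (2 * n)
  have h1 : ∀ k : Fin n → ℤ, 1 ≤ ENNReal.ofReal C * (latDecay k * expWeight w k) := by
    intro k
    unfold latDecay expWeight
    rw [← ENNReal.ofReal_mul (by positivity), ← ENNReal.ofReal_mul hC.le, ← ENNReal.ofReal_one]
    refine ENNReal.ofReal_le_ofReal ?_
    have h2 := h ‖lat k‖ (norm_nonneg _)
    have h3 : Real.exp (w ‖lat k‖ / 2) ≤ Real.exp (w ‖lat k‖) :=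
      Real.exp_le_exp.2 (by linarith [hw.1.one_le ‖lat k‖ (norm_nonneg _)])
    rw [mul_left_comm, inv_mul_eq_div, one_le_div (by positivity)]
    exact h2.trans (by gcongr)
  have h4 := hf.2
  rw [modNorm_eq hρ w q hf.1] at h4
  calc ∑' k, eLpNorm (op (sigmaS hρ k) f) p volume
      ≤ ∑' k, ENNReal.ofReal C *
          (latDecay k * (expWeight w k * eLpNorm (op (sigmaS hρ k) f) p volume)) := by
        gcongr with k
        calc _ ≤ ENNReal.ofReal C * (latDecay k * expWeight w k) *
              eLpNorm (op (sigmaS hρ k) f) p volume := le_mul_of_one_le_left' (h1 k)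
          _ = _ := by ring
    _ ≤ ENNReal.ofReal C * ((∑' l : Fin n → ℤ, latDecay l) *
          ellNorm q fun k => expWeight w k * eLpNorm (op (sigmaS hρ k) f) p volume) := by
        rw [ENNReal.tsum_mul_left]
        gcongr
        exact tsum_latDecay_mul_le hq _
    _ < ⊤ := ENNReal.mul_lt_top ENNReal.ofReal_lt_top
        (ENNReal.mul_lt_top (tsum_lattice_lt_top n) h4)

theorem modNorm_mul_le (hρ : IsWindow ρ) (hw : w ∈ weightsZero) (hq : 1 ≤ q) [Fact (1 ≤ p)]
    (N : ℕ) : ∃ C : ℝ, 0 < C ∧ ∀ R : ℝ, 0 < R →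
      ∀ f ∈ modSpace ρ w p q, ∀ g ∈ modSpace ρ w p q,
        (∀ l, eLpNorm (op (sigmaS hρ l) f) p volume = 0 ∨ R ≤ 1 + ‖lat l‖) →
        (∀ l, eLpNorm (op (sigmaS hρ l) g) p volume = 0 ∨ R ≤ 1 + ‖lat l‖) →
        modNorm ρ w p q (f * g) ≤
          ENNReal.ofReal (C * (R ^ N)⁻¹) * modNorm ρ w p q f * modNorm ρ w p q g := by
  obtain ⟨D, hD, hDle⟩ := eLpNorm_op_mul_le hρ p
  obtain ⟨C, hC, h⟩ := ellNorm_expWeight_le hw hq n N D hD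
  refine ⟨C, hC, fun R hR f hf g hg hfR hgR => ?_⟩
  have hfd := decomposable_of_mem_modSpace hρ hw hq hf
  have hgd := decomposable_of_mem_modSpace hρ hw hq hg
  rw [modNorm_eq hρ w q hf.1, modNorm_eq hρ w q hg.1, modNorm_eq hρ w q (hfd.memLp_mul hgd)]
  exact h R hR _ _ _ hfR hgR (hDle f g hfd hgd)

theorem mul_mem_modSpace (hρ : IsWindow ρ) (hw : w ∈ weightsZero) (hq : 1 ≤ q) [Fact (1 ≤ p)]
    {f g : E n → ℂ} (hf : f ∈ modSpace ρ w p q) (hg : g ∈ modSpace ρ w p q) :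
    f * g ∈ modSpace ρ w p q := by
  have hfd := decomposable_of_mem_modSpace hρ hw hq hf
  have hgd := decomposable_of_mem_modSpace hρ hw hq hg
  obtain ⟨C, -, h⟩ := modNorm_mul_le (p := p) hρ hw hq 0
  -- With `R = 1` the frequency restriction holds for every lattice point.
  refine ⟨hfd.memLp_mul hgd, (h 1 one_pos f hf g hg ?_ ?_).trans_lt
    (ENNReal.mul_lt_top (ENNReal.mul_lt_top ENNReal.ofReal_lt_top hf.2) hg.2)⟩ <;>
  exact fun l => Or.inr (by linarith [norm_nonneg (lat l)])

theorem add_mem_modSpace (hρ : IsWindow ρ) (hq : 1 ≤ q) [hp : Fact (1 ≤ p)]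
    {f g : E n → ℂ} (hf : f ∈ modSpace ρ w p q) (hg : g ∈ modSpace ρ w p q) :
    f + g ∈ modSpace ρ w p q := by
  refine ⟨hf.1.add hg.1, lt_of_le_of_lt ?_ (ENNReal.add_lt_top.2 ⟨hf.2, hg.2⟩)⟩
  rw [modNorm_eq hρ w q hf.1, modNorm_eq hρ w q hg.1, modNorm_eq hρ w q (hf.1.add hg.1)]
  refine (ellNorm_mono fun k => ?_).trans (ellNorm_add_le hq _ _)
  rw [← mul_add, op_add hp.out hf.1 hg.1]
  gcongr
  exact eLpNorm_add_le (memLp_op hp.out hf.1 _).1 (memLp_op hp.out hg.1 _).1 hp.out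

theorem smul_mem_modSpace (hρ : IsWindow ρ) (hq : 1 ≤ q) [Fact (1 ≤ p)] (c : ℂ)
    {f : E n → ℂ} (hf : f ∈ modSpace ρ w p q) : c • f ∈ modSpace ρ w p q := by
  refine ⟨hf.1.const_smul c, ?_⟩
  have h := hf.2
  rw [modNorm_eq hρ w q hf.1] at h
  rw [modNorm_eq hρ w q (hf.1.const_smul c)]
  simp only [op_smul, eLpNorm_const_smul, mul_left_comm _ ‖c‖ₑ]
  rw [ellNorm_const_mul hq]
  exact ENNReal.mul_lt_top enorm_lt_top h

theorem zero_mem_modSpace (hρ : IsWindow ρ) (hq : 1 ≤ q) [Fact (1 ≤ p)] :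
    (0 : E n → ℂ) ∈ modSpace ρ w p q := by
  refine ⟨MemLp.zero, ?_⟩
  have h0 : ∀ χ : 𝓢(E n, ℂ), op χ (0 : E n → ℂ) = 0 := fun χ => by
    ext y
    simp [op]
  rw [modNorm_eq hρ w q MemLp.zero]
  simp only [h0, eLpNorm_zero, mul_zero]
  have h1 := ellNorm_const_mul hq 0 (fun _ : Fin n → ℤ => 0)
  rw [zero_mul] at h1
  simp only [zero_mul] at h1
  rw [h1]
  exact ENNReal.zero_lt_top

theorem spec_add_subset [hp : Fact (1 ≤ p)] {f g : E n → ℂ} (hf : MemLp f p volume)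
    (hg : MemLp g p volume) : spec p (f + g) ⊆ spec p f ∪ spec p g := by
  refine spec_subset (hf.add hg)
    (Distribution.isClosed_dsupport.union Distribution.isClosed_dsupport) fun ψ hψ hd => ?_
  rw [Set.disjoint_union_right] at hd
  rw [pair_add hp.out hf hg, pair_eq_zero_of_disjoint hf hψ hd.1,
    pair_eq_zero_of_disjoint hg hψ hd.2, add_zero]

theorem spec_smul_subset [Fact (1 ≤ p)] (c : ℂ) {f : E n → ℂ} (hf : MemLp f p volume) :
    spec p (c • f) ⊆ spec p f := by
  refine spec_subset (hf.const_smul c) Distribution.isClosed_dsupport fun ψ hψ hd => ?_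
  rw [pair_smul, pair_eq_zero_of_disjoint hf hψ hd, mul_zero]

theorem spec_zero_subset [Fact (1 ≤ p)] (C : Set (E n)) : spec p (0 : E n → ℂ) ⊆ C :=
  (spec_subset MemLp.zero isClosed_empty fun ψ _ _ => by simp [pair]).trans (Set.empty_subset C)

/-! ### Sums of frequencies in an orthant -/

theorem sign_add_of_sign_eq {a b s : ℝ} (hs : s ≠ 0) (ha : Real.sign a = s)
    (hb : Real.sign b = s) : Real.sign (a + b) = s ∧ |a + b| = |a| + |b| := by
  rcases lt_trichotomy a 0 with h | h | h
  · rw [Real.sign_of_neg h] at ha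
    rcases lt_trichotomy b 0 with h' | h' | h'
    · rw [Real.sign_of_neg (add_neg h h'), abs_of_neg h, abs_of_neg h', abs_of_neg (add_neg h h')]
      exact ⟨ha, by ring⟩
    · rw [h', Real.sign_zero] at hb
      exact absurd hb.symm hs
    · rw [Real.sign_of_pos h'] at hb
      linarith
  · rw [h, Real.sign_zero] at ha
    exact absurd ha.symm hs
  · rw [Real.sign_of_pos h] at ha
    rcases lt_trichotomy b 0 with h' | h' | h'
    · rw [Real.sign_of_neg h'] at hb
      linarith
    · rw [h', Real.sign_zero] at hb
      exact absurd hb.symm hs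
    · rw [Real.sign_of_pos (add_pos h h'), abs_of_pos h, abs_of_pos h', abs_of_pos (add_pos h h')]
      exact ⟨ha, rfl⟩

theorem abs_add_of_mem_orthant {ε : Fin n → Fin 2} {R : ℝ} {a b : E n} (ha : a ∈ orthant ε R)
    (hb : b ∈ orthant ε R) (j : Fin n) :
    Real.sign ((a + b) j) = (-1) ^ (ε j : ℕ) ∧ |(a + b) j| = |a j| + |b j| :=
  sign_add_of_sign_eq (pow_ne_zero _ (by norm_num)) (ha.1 j) (hb.1 j)

theorem add_mem_orthant {ε : Fin n → Fin 2} {R : ℝ} {a b : E n} (ha : a ∈ orthant ε R)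
    (hb : b ∈ orthant ε R) : a + b ∈ orthant ε R := by
  refine ⟨fun j => (abs_add_of_mem_orthant ha hb j).1, fun hc => ha.2 fun j => ?_⟩
  have h := hc j
  rw [(abs_add_of_mem_orthant ha hb j).2] at h
  linarith [abs_nonneg (b j)]

theorem norm_le_of_mem_orthant {ε : Fin n → Fin 2} {R : ℝ} {a b : E n} (ha : a ∈ orthant ε R)
    (hb : b ∈ orthant ε R) : ‖a‖ ≤ ‖a + b‖ := by
  rw [EuclideanSpace.norm_eq, EuclideanSpace.norm_eq]
  gcongr with j
  rw [Real.norm_eq_abs, Real.norm_eq_abs, (abs_add_of_mem_orthant ha hb j).2]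
  linarith [abs_nonneg (b j)]

open scoped Pointwise in
-- Without cancellation `‖a‖ ≤ ‖a + b‖`, so near a given point only a compact part of `A`
-- contributes, and compact plus closed is closed.
theorem isClosed_add_of_subset_orthant {ε : Fin n → Fin 2} {R : ℝ} {A B : Set (E n)}
    (hA : IsClosed A) (hB : IsClosed B) (hAo : A ⊆ orthant ε R) (hBo : B ⊆ orthant ε R) :
    IsClosed (A + B) := by
  rw [← closure_subset_iff_isClosed]
  intro z hz
  have hAc : IsCompact (A ∩ Metric.closedBall 0 (‖z‖ + 1)) :=
    (isCompact_closedBall _ _).inter_left hA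
  have hcl : IsClosed (A ∩ Metric.closedBall 0 (‖z‖ + 1) + B) := hB.add_left_of_isCompact hAc
  have hz' : z ∈ closure (A ∩ Metric.closedBall 0 (‖z‖ + 1) + B) := by
    rw [mem_closure_iff_nhds] at hz ⊢
    intro t ht
    obtain ⟨_, ⟨hyt, hyb⟩, a, ha, b, hb, rfl⟩ :=
      hz (t ∩ Metric.ball z 1) (Filter.inter_mem ht (Metric.ball_mem_nhds z one_pos))
    refine ⟨a + b, hyt, a, ⟨ha, ?_⟩, b, hb, rfl⟩
    rw [mem_closedBall_zero_iff]
    have h1 : ‖a + b - z‖ < 1 := mem_ball_iff_norm.1 hyb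
    have h2 : ‖a + b‖ ≤ ‖a + b - z‖ + ‖z‖ := by
      simpa using norm_add_le (a + b - z) z
    linarith [norm_le_of_mem_orthant (hAo ha) (hBo hb)]
  rw [hcl.closure_eq] at hz'
  exact Set.add_subset_add_right Set.inter_subset_left hz'

open scoped Pointwise in
-- `P_R(ε)` need not be closed, so the spectrum of the product is confined instead to the sum of the
-- two spectra, a closed subset of it.
theorem mul_mem_modSpaceSupp (hρ : IsWindow ρ) (hw : w ∈ weightsZero) (hq : 1 ≤ q)
    [Fact (1 ≤ p)] {ε : Fin n → Fin 2} {R : ℝ} {f g : E n → ℂ}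
    (hf : f ∈ modSpaceSupp ρ w p q ε R) (hg : g ∈ modSpaceSupp ρ w p q ε R) :
    f * g ∈ modSpaceSupp ρ w p q ε R := by
  refine ⟨mul_mem_modSpace hρ hw hq hf.1 hg.1, ?_⟩
  have hfd := decomposable_of_mem_modSpace hρ hw hq hf.1
  have hgd := decomposable_of_mem_modSpace hρ hw hq hg.1
  refine (hfd.spec_mul_subset hgd (isClosed_add_of_subset_orthant
    Distribution.isClosed_dsupport Distribution.isClosed_dsupport hf.2 hg.2)
    fun ζ hζ η hη => Set.add_mem_add hζ hη).trans ?_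
  rintro _ ⟨a, ha, b, hb, rfl⟩
  exact add_mem_orthant (hf.2 ha) (hg.2 hb)

/-- Only the pieces of high frequency contribute to a function with spectrum in `P_R(ε)`. -/
theorem eLpNorm_op_sigmaS_eq_zero_or (hρ : IsWindow ρ) [hp : Fact (1 ≤ p)] {ε : Fin n → Fin 2}
    {R : ℝ} {f : E n → ℂ} (hf : f ∈ modSpaceSupp ρ w p q ε R) (l : Fin n → ℤ) :
    eLpNorm (op (sigmaS hρ l) f) p volume = 0 ∨ R ≤ 1 + ‖lat l‖ := by
  by_cases hd : Disjoint (tsupport (sigmaS hρ l)) (spec p f)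
  · left
    have h0 : op (sigmaS hρ l) f =ᵐ[volume] 0 := by
      refine ae_eq_of_pair_eq hp.out hp.out (memLp_op hp.out hf.1.1 _) MemLp.zero fun φ _ => ?_
      rw [pair_op hp.out hf.1.1, pair_eq_zero_of_disjoint hf.1.1
        (hasCompactSupport_mulS (hasCompactSupport_sigmaS hρ l) _)
        (hd.mono_left (tsupport_mulS_subset_left _ _))]
      simp [pair]
    rw [eLpNorm_congr_ae h0, eLpNorm_zero]
  · right
    obtain ⟨ξ, hξ, hξ'⟩ := Set.not_disjoint_iff.1 hd
    obtain ⟨j, hj⟩ : ∃ j, R < |ξ j| := by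
      by_contra! hcon
      exact (hf.2 hξ').2 hcon
    have h1 := tsupport_sigmaS_subset hρ l hξ j
    have h2 := abs_le_norm_lat l j
    have h3 : |ξ j| ≤ |ξ j - l j| + |(l j : ℝ)| := by
      simpa using abs_add_le (ξ j - l j) (l j : ℝ)
    linarith

/-- The weighted modulation space as an algebra under pointwise multiplication. -/
def modAlgebra (hρ : IsWindow ρ) (hw : w ∈ weightsZero) (p : ℝ≥0∞) [Fact (1 ≤ p)] (hq : 1 ≤ q) :
    NonUnitalSubalgebra ℂ (E n → ℂ) where
  carrier := modSpace ρ w p q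
  add_mem' := add_mem_modSpace hρ hq
  zero_mem' := zero_mem_modSpace hρ hq
  mul_mem' := mul_mem_modSpace hρ hw hq
  smul_mem' c _ hf := smul_mem_modSpace hρ hq c hf

/-- The algebra of functions in the modulation space with spectrum in `P_R(ε)`. -/
def modAlgebraSupp (hρ : IsWindow ρ) (hw : w ∈ weightsZero) (p : ℝ≥0∞) [Fact (1 ≤ p)]
    (hq : 1 ≤ q) (ε : Fin n → Fin 2) (R : ℝ) : NonUnitalSubalgebra ℂ (E n → ℂ) where
  carrier := modSpaceSupp ρ w p q ε R
  add_mem' hf hg := ⟨add_mem_modSpace hρ hq hf.1 hg.1,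
    (spec_add_subset hf.1.1 hg.1.1).trans (Set.union_subset hf.2 hg.2)⟩
  zero_mem' := ⟨zero_mem_modSpace hρ hq, spec_zero_subset _⟩
  mul_mem' := mul_mem_modSpaceSupp hρ hw hq
  smul_mem' c _ hf := ⟨smul_mem_modSpace hρ hq c hf.1, (spec_smul_subset c hf.1.1).trans hf.2⟩

end modSpace

end UltraMod

end

/-! ### The subalgebra property and the norm estimate -/

theorem mainTheorem8 (n : ℕ) (ρ : UltraMod.E n → ℝ) (hρ : UltraMod.IsWindow ρ)
    (p q : ℝ≥0∞) [Fact (1 ≤ p)] (hq : 1 ≤ q)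
    (w : ℝ → ℝ) (hw : w ∈ UltraMod.weightsZero) :
    (∀ (ε : Fin n → Fin 2) (R : ℝ), 2 ≤ R →
      ∃ A B : NonUnitalSubalgebra ℂ (UltraMod.E n → ℂ),
        (A : Set (UltraMod.E n → ℂ)) = UltraMod.modSpace ρ w p q ∧
        (B : Set (UltraMod.E n → ℂ)) = UltraMod.modSpaceSupp ρ w p q ε R ∧
        B ≤ A) ∧
    (∀ N : ℕ, ∃ C : ℝ, 0 < C ∧
      ∀ (ε : Fin n → Fin 2) (R : ℝ), 2 ≤ R →
        ∀ f ∈ UltraMod.modSpaceSupp ρ w p q ε R, ∀ g ∈ UltraMod.modSpaceSupp ρ w p q ε R,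
          UltraMod.modNorm ρ w p q (f * g) ≤
            ENNReal.ofReal (C * (R ^ N)⁻¹) *
              UltraMod.modNorm ρ w p q f * UltraMod.modNorm ρ w p q g) := by
  refine ⟨fun ε R _ => ⟨UltraMod.modAlgebra hρ hw p hq, UltraMod.modAlgebraSupp hρ hw p hq ε R,
    rfl, rfl, fun f hf => hf.1⟩, fun N => ?_⟩
  obtain ⟨C, hC, h⟩ := UltraMod.modNorm_mul_le (p := p) hρ hw hq N
  refine ⟨C, hC, fun ε R hR f hf g hg => h R (by linarith) f hf.1 g hg.1 ?_ ?_⟩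
  · exact UltraMod.eLpNorm_op_sigmaS_eq_zero_or hρ hf
  · exact UltraMod.eLpNorm_op_sigmaS_eq_zero_or hρ hg
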